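/- For $n\ge 1$ let $NC(n)$ be the poset of non-crossing partitions of $\{1,\dots,n\}$ under reverse refinement, with minimum $0_n$ (all blocks are singletons) and maximum $1_n$ (one block); $|\pi|$ is the number of blocks of $\pi$. For a non-empty $W=\{p_1<\cdots<p_m\}\subseteq\{1,\dots,n\}$ let $\pi_W\in NC(m)$ be the relabeled restriction ($i,j$ are in the same block of $\pi_W$ iff $p_i,p_j$ are in the same block of $\pi$), and let $\mathrm{Kr}(\pi)\in NC(n)$ be the Kreweras complement: the largest partition of $1',\dots,n'$ whose union with $\pi$ is non-crossing on $1<1'<2<2'<\cdots<n<n'$. *The group $\widetilde{\mathcal G}$ and its subgroup $\mathcal G$.* Functions $f,g$ on the pairs $\pi\le\sigma$ in $NC(n)$, $n\ge1$, with values in $\mathbb C$, are multiplied by convolution, $(f*g)(\pi,\sigma)=\sum_{\pi\le\rho\le\sigma}f(\pi,\rho)\,g(\rho,\sigma)$. Let $\widetilde{\mathcal G}$ be the set of such $g$ with $g(\pi,\pi)=1$ and $g(\pi,\sigma)=\prod_{W\in\sigma}g(\pi_W,1_{|W|})$ for all $\pi\le\sigma$, and let $\mathcal G$ be the set of those $g\in\widetilde{\mathcal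 G}$ with $g(\pi,1_n)=g(0_n,\mathrm{Kr}(\pi))$ for all $n\ge1$ and $\pi\in NC(n)$. *The algebra $\mathcal T$.* Let $\mathcal T=\mathbb C[X_\pi : \pi\in\bigsqcup_{n\ge1}(NC(n)\setminus\{1_n\})]$ and $X_{1_n}:=1$, with the algebra homomorphisms $\Delta:\mathcal T\to\mathcal T\otimes\mathcal T$, $\Delta(X_\pi)=\sum_{\sigma\ge\pi}\bigl(\prod_{W\in\sigma}X_{\pi_W}\bigr)\otimes X_\sigma$, and $\varepsilon:\mathcal T\to\mathbb C$, $\varepsilon(X_\pi)=0$ for $\pi\ne1_n$, and with the grading in which $X_\pi$ has degree $|\pi|-1$. *The algebra $\mathrm{Sym}$.* Let $\mathrm{Sym}=\mathbb C[Y_2,Y_3,\dots]$ (the Hopf algebra of symmetric functions, presented through its parking-function generators) and $Y_1:=1$, with the algebra homomorphisms $\Delta:\mathrm{Sym}\to\mathrm{Sym}\otimes\mathrm{Sym}$, $\Delta(Y_n)=\sum_{\pi\in NC(n)}\bigl(\prod_{V\in\pi}Y_{|V|}\bigr)\otimes\bigl(\prod_{W\in\mathrm{Kr}(\pi)}Y_{|W|}\bigr)$,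 and $\varepsilon:\mathrm{Sym}\to\mathbb C$, $\varepsilon(Y_n)=0$ for $n\ge2$, and with the grading in which $Y_n$ has degree $n-1$. For $A\in\{\mathcal T,\mathrm{Sym}\}$ let $\mathbb X(A)$ be the set of characters of $A$ (unital algebra homomorphisms $A\to\mathbb C$), with the convolution $\chi_1*\chi_2=(\chi_1\otimes\chi_2)\circ\Delta$, where $\mathbb C\otimes\mathbb C$ is identified with $\mathbb C$. **Theorem.** 1. $\mathcal T$ and $\mathrm{Sym}$, with these structures, are graded connected bialgebras. The unital algebra homomorphism $\Psi:\mathcal T\to\mathrm{Sym}$ given on the indeterminates by $\Psi(X_\pi)=\prod_{W\in\mathrm{Kr}(\pi)}Y_{|W|}$ satisfies this formula for all $\pi\in NC(n)$, $n\ge1$, and it is a surjective homomorphism of graded connected bialgebras: it respects the comultiplications, the counits and the gradings. 2. $\mathbb X(\mathcal T)$ and $\mathbb X(\mathrm{Sym})$ are groups under convolution, with the counits as units, and $\Psi^*(\chi):=\chi\circ\Psi$ defines an injective group homomorphism $\Psi^*:\mathbb X(\mathrm{Sym})\to\mathbb X(\mathcal T)$. 3. $\widetilde{\mathcal G}$ is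 a group under convolution and $\mathcal G$ is a subgroup of it. There are group isomorphisms $\widetilde{\mathcal G}\to\mathbb X(\mathcal T)$, $g\mapsto\chi_g$, with $\chi_g(X_\pi)=g(\pi,1_n)$ for all $n\ge1$ and $\pi\in NC(n)$, and $\mathcal G\to\mathbb X(\mathrm{Sym})$, $f\mapsto\widehat\chi_f$, with $\widehat\chi_f(Y_n)=f(0_n,1_n)$ for all $n\ge1$. Under these identifications $\Psi^*$ is the inclusion of $\mathcal G$ into $\widetilde{\mathcal G}$, i.e. $\Psi^*(\widehat\chi_f)=\chi_f$ for all $f\in\mathcal G$. -/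

import Mathlib

open scoped TensorProduct

namespace NCHopf

/-! ### Non-crossing partitions -/

/-- A relation `r` on a set of points placed on the line at the positions `pos` is non-crossing:
there are no four points at positions `a < b < c < d` with `a, c` in one block and `b, d` in
another block. -/
def IsNoncrossing {α : Type*} (pos : α → ℕ) (r : α → α → Prop) : Prop :=
  ∀ a b c d : α, pos a < pos b → pos b < pos c → pos c < pos d → r a c → r b d → r a b

/-- `NC n`: the non-crossing partitions of an `n`-element linearly ordered set. A partition is
given by the equivalence relation "being in the same block". -/
def NC (n : ℕ) : Type :=
  {s : Setoid (Fin n) // IsNoncrossing (fun i : Fin n => (i : ℕ)) (fun i j => s i j)}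

namespace NC

variable {n : ℕ}

/-- `i` and `j` belong to the same block of `π`. -/
def Rel (π : NC n) (i j : Fin n) : Prop := π.1 i j

theorem Rel.refl (π : NC n) (i : Fin n) : π.Rel i i := π.1.refl' i

theorem Rel.symm {π : NC n} {i j : Fin n} (h : π.Rel i j) : π.Rel j i := π.1.symm' h

theorem Rel.trans {π : NC n} {i j k : Fin n} (h : π.Rel i j) (h' : π.Rel j k) : π.Rel i k :=
  π.1.trans' h h'

/-- Reverse refinement order: `π ≤ σ` iff points in the same block of `π` are in the same block
of `σ`, i.e. iff every block of `σ` is a union of blocks of `π`. -/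
instance : PartialOrder (NC n) :=
  inferInstanceAs (PartialOrder
    {s : Setoid (Fin n) // IsNoncrossing (fun i : Fin n => (i : ℕ)) (fun i j => s i j)})

theorem le_iff {π σ : NC n} : π ≤ σ ↔ ∀ i j, π.Rel i j → σ.Rel i j :=
  ⟨fun h _ _ hij => h hij, fun h _ _ hij => h _ _ hij⟩

/-- `⊥` is the partition `0_n` into singletons and `⊤` is the one-block partition `1_n`. -/
instance : BoundedOrder (NC n) where
  top := ⟨⊤, fun _ _ _ _ _ _ _ _ _ => trivial⟩
  le_top _ _ _ _ := trivial
  bot := ⟨⊥, fun a b c d h1 h2 _ hac _ => by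
    have hac' : a = c := hac
    subst hac'
    exact absurd (h1.trans h2) (lt_irrefl _)⟩
  bot_le π i j h := by
    have h' : i = j := h
    subst h'
    exact π.1.refl' i

instance : Finite (NC n) :=
  Finite.of_injective (fun π : NC n => fun i j => π.Rel i j) fun _ _ h =>
    Subtype.ext (Setoid.ext fun i j => iff_of_eq (congrFun (congrFun h i) j))

noncomputable instance : Fintype (NC n) := Fintype.ofFinite _

noncomputable instance : DecidableEq (NC n) := Classical.decEq _

open Classical in
noncomputable instance : LocallyFiniteOrder (NC n) := Fintype.toLocallyFiniteOrder

open Classical in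
/-- The set of blocks of `π`. -/
noncomputable def blocks (π : NC n) : Finset (Finset (Fin n)) :=
  Finset.univ.image fun i => Finset.univ.filter fun j => π.Rel i j

theorem card_pos_of_mem_blocks {π : NC n} {W : Finset (Fin n)} (hW : W ∈ π.blocks) :
    0 < W.card := by
  classical
  obtain ⟨i, -, rfl⟩ := Finset.mem_image.1 hW
  exact Finset.card_pos.2 ⟨i, by simpa using Rel.refl π i⟩

/-- The relabeled restriction `π_W`: if `W = {p_1 < ⋯ < p_m}`, then `i` and `j` are in the same
block of `π_W` iff `p_i` and `p_j` are in the same block of `π`. -/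
def restrict (π : NC n) (W : Finset (Fin n)) : NC W.card :=
  ⟨Setoid.comap (W.orderEmbOfFin rfl) π.1, fun _ _ _ _ h1 h2 h3 hac hbd =>
    π.2 _ _ _ _ ((W.orderEmbOfFin rfl).lt_iff_lt.2 h1) ((W.orderEmbOfFin rfl).lt_iff_lt.2 h2)
      ((W.orderEmbOfFin rfl).lt_iff_lt.2 h3) hac hbd⟩

/-- The Kreweras complement. With the points ordered as `1, 1', 2, 2', …, n, n'`, the points `i'`
and `j'` (`i ≤ j`) may be joined without crossing a block of `π` exactly when the set
`{i + 1, …, j}` lying between them is a union of blocks of `π`; the Kreweras complement joins all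
these pairs. It is the largest partition of `1', …, n'` whose union with `π` is non-crossing, see
`kr_isGreatest`. -/
def kr (π : NC n) : NC n :=
  ⟨{ r := fun i j => ∀ a b, π.Rel a b →
        (a ∈ Set.Ioc (min i j) (max i j) ↔ b ∈ Set.Ioc (min i j) (max i j))
     iseqv :=
      { refl := fun i a b _ => by simp
        symm := fun {i j} h a b hab => by
          rw [min_comm, max_comm]; exact h a b hab
        trans := fun {i j k} h h' a b hab => by
          have h1 := h a b hab
          have h2 := h' a b hab
          simp only [Set.mem_Ioc, min_lt_iff, le_max_iff] at h1 h2 ⊢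
          omega } },
    fun i j k l h1 h2 h3 hik hjl a b hab => by
      have h1' : i < j := h1
      have h2' : j < k := h2
      have h3' : k < l := h3
      have e1 := hik a b hab
      have e2 := hjl a b hab
      simp only [Set.mem_Ioc, min_lt_iff, le_max_iff] at e1 e2 ⊢
      omega⟩

/-- The position of a point of `π` (left summand) or of `σ` (right summand) in the interleaved
order `1, 1', 2, 2', …, n, n'`. -/
def interleavePos : Fin n ⊕ Fin n → ℕ
  | Sum.inl i => 2 * i
  | Sum.inr i => 2 * i + 1

/-- The partition `π ∪ σ` of the points `1, 1', 2, 2', …, n, n'`, with `π` on the points `i` and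
`σ` on the points `i'`. -/
def interleaveRel (π σ : NC n) : Fin n ⊕ Fin n → Fin n ⊕ Fin n → Prop
  | Sum.inl i, Sum.inl j => π.Rel i j
  | Sum.inr i, Sum.inr j => σ.Rel i j
  | _, _ => False

theorem kr_isGreatest (π : NC n) :
    IsGreatest {σ : NC n | IsNoncrossing interleavePos (interleaveRel π σ)} π.kr := by
  constructor
  · rintro (a | a) (b | b) (c | c) (d | d) h1 h2 h3 hac hbd <;>
      simp only [interleaveRel, interleavePos] at h1 h2 h3 hac hbd ⊢
    · exact π.2 a b c d (by simpa using h1) (by simpa using h2) (by simpa using h3) hac hbd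
    · have := hbd a c hac
      simp only [Set.mem_Ioc, min_lt_iff, le_max_iff] at this
      omega
    · have := hac b d hbd
      simp only [Set.mem_Ioc, min_lt_iff, le_max_iff] at this
      omega
    · exact π.kr.2 a b c d (show (a : ℕ) < b by omega) (show (b : ℕ) < c by omega)
        (show (c : ℕ) < d by omega) hac hbd
  · intro σ hσ
    have key : ∀ i j : Fin n, i ≤ j → σ.Rel i j → ∀ a b, π.Rel a b →
        (i < a ∧ a ≤ j) → (i < b ∧ b ≤ j) := by
      intro i j hij hs a b hab ha
      by_contra hb
      have hb' : b ≤ i ∨ j < b := by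
        by_contra hcon
        push Not at hcon
        exact hb hcon
      rcases hb' with hb' | hb'
      · exact hσ (Sum.inl b) (Sum.inr i) (Sum.inl a) (Sum.inr j)
          (by simp only [interleavePos]; omega) (by simp only [interleavePos]; omega)
          (by simp only [interleavePos]; omega) hab.symm hs
      · exact hσ (Sum.inr i) (Sum.inl a) (Sum.inr j) (Sum.inl b)
          (by simp only [interleavePos]; omega) (by simp only [interleavePos]; omega)
          (by simp only [interleavePos]; omega) hs hab
    intro i j hs a b hab
    rcases le_total i j with hij | hij
    · simp only [min_eq_left hij, max_eq_right hij, Set.mem_Ioc]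
      exact ⟨key i j hij hs a b hab, key i j hij hs b a hab.symm⟩
    · simp only [min_eq_right hij, max_eq_left hij, Set.mem_Ioc]
      exact ⟨key j i hij (Rel.symm hs) a b hab, key j i hij (Rel.symm hs) b a hab.symm⟩

end NC

/-! ### The groups of semi-multiplicative and of multiplicative functions -/

/-- The disjoint union of the posets `NC(n)`, `n ≥ 1`. -/
abbrev NCAll : Type := Σ n : {n : ℕ // 0 < n}, NC n.1

/-- The incidence algebra of non-crossing partitions, with convolution as product. -/
abbrev IncAlg : Type := IncidenceAlgebra ℂ NCAll

/-- The value `g(π, σ)` for `π, σ ∈ NC(n)`, `n ≥ 1`. -/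
def ev (g : IncAlg) {n : ℕ} (hn : 0 < n) (π σ : NC n) : ℂ := g ⟨⟨n, hn⟩, π⟩ ⟨⟨n, hn⟩, σ⟩

/-- The unitized semi-multiplicative functions: `g(π, π) = 1` and
`g(π, σ) = ∏_{W ∈ σ} g(π_W, 1_{|W|})` for all `π ≤ σ`. -/
def semiMultiplicative : Set IncAlg :=
  {g | (∀ (n : ℕ) (hn : 0 < n) (π : NC n), ev g hn π π = 1) ∧
    ∀ (n : ℕ) (hn : 0 < n) (π σ : NC n), π ≤ σ →
      ev g hn π σ =
        ∏ W : σ.blocks, ev g (NC.card_pos_of_mem_blocks W.2) (π.restrict W.1) ⊤}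

/-- The unitized multiplicative functions: those unitized semi-multiplicative `g` with
`g(π, 1_n) = g(0_n, Kr(π))` for all `π ∈ NC(n)`. -/
def multiplicative : Set IncAlg :=
  {g | g ∈ semiMultiplicative ∧
    ∀ (n : ℕ) (hn : 0 < n) (π : NC n), ev g hn π ⊤ = ev g hn ⊥ π.kr}

/-! ### The algebra `T` -/

/-- The indeterminates of `T`: the partitions `π ∈ NC(n)` with `π ≠ 1_n`, for `n ≥ 1` (for `n = 0`
there is no such `π`). -/
abbrev TIndex : Type := {p : Σ n : ℕ, NC n // p.2 ≠ ⊤}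

/-- `T = ℂ[X_π | π ∈ ⊔_n NC(n) ∖ {1_n}]`. -/
abbrev T : Type := MvPolynomial TIndex ℂ

/-- The element `X_π` of `T`, with `X_{1_n} = 1`. -/
noncomputable def X {n : ℕ} (π : NC n) : T :=
  if h : π = ⊤ then 1 else MvPolynomial.X ⟨⟨n, π⟩, h⟩

/-- The comultiplication of `T`: the algebra homomorphism with
`Δ(X_π) = ∑_{σ ≥ π} (∏_{W ∈ σ} X_{π_W}) ⊗ X_σ`. -/
noncomputable def comulT : T →ₐ[ℂ] T ⊗[ℂ] T :=
  MvPolynomial.aeval fun p : TIndex =>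
    ∑ σ ∈ Finset.Ici p.1.2, (∏ W ∈ σ.blocks, X (p.1.2.restrict W)) ⊗ₜ[ℂ] X σ

/-- The counit of `T`: the algebra homomorphism with `ε(X_π) = 0` for `π ≠ 1_n`. -/
noncomputable def counitT : T →ₐ[ℂ] ℂ := MvPolynomial.aeval fun _ : TIndex => (0 : ℂ)

/-- The grading of `T`: `X_π` has degree `|π| - 1`, where `|π|` is the number of blocks. -/
noncomputable def gradT (m : ℕ) : Submodule ℂ T :=
  MvPolynomial.weightedHomogeneousSubmodule ℂ (fun p : TIndex => p.1.2.blocks.card - 1) m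

/-! ### The algebra `Sym` -/

/-- `Sym = ℂ[Y_2, Y_3, …]`, the algebra of symmetric functions presented through the
parking-function generators. -/
abbrev SymAlg : Type := MvPolynomial {n : ℕ // 2 ≤ n} ℂ

/-- The parking-function generator `Y_n`, with `Y_1 = 1` (`Y_0 = 1` is a default value). -/
noncomputable def Y (n : ℕ) : SymAlg :=
  if h : 2 ≤ n then MvPolynomial.X ⟨n, h⟩ else 1

/-- `Y_π = ∏_{V ∈ π} Y_{|V|}`. -/
noncomputable def YP {n : ℕ} (π : NC n) : SymAlg := ∏ V ∈ π.blocks, Y V.card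

/-- The comultiplication of `Sym`: the algebra homomorphism with
`Δ(Y_n) = ∑_{π ∈ NC(n)} Y_π ⊗ Y_{Kr(π)}`. -/
noncomputable def comulSym : SymAlg →ₐ[ℂ] SymAlg ⊗[ℂ] SymAlg :=
  MvPolynomial.aeval fun n : {n : ℕ // 2 ≤ n} => ∑ π : NC n.1, YP π ⊗ₜ[ℂ] YP π.kr

/-- The counit of `Sym`: the algebra homomorphism with `ε(Y_n) = 0` for `n ≥ 2`. -/
noncomputable def counitSym : SymAlg →ₐ[ℂ] ℂ :=
  MvPolynomial.aeval fun _ : {n : ℕ // 2 ≤ n} => (0 : ℂ)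

/-- The grading of `Sym`: `Y_n` has degree `n - 1`. -/
noncomputable def gradSym (m : ℕ) : Submodule ℂ SymAlg :=
  MvPolynomial.weightedHomogeneousSubmodule ℂ (fun n : {n : ℕ // 2 ≤ n} => n.1 - 1) m

/-- The algebra homomorphism `Ψ : T → Sym` with `Ψ(X_π) = ∏_{W ∈ Kr(π)} Y_{|W|}`. -/
noncomputable def Psi : T →ₐ[ℂ] SymAlg := MvPolynomial.aeval fun p : TIndex => YP p.1.2.kr

/-! ### Graded connected bialgebras and characters

The structure maps are given as algebra homomorphisms, and not through the class `Bialgebra`: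
Mathlib's polynomial rings already carry an instance of it (as monoid algebras), which is not the
one considered here. -/

section

variable {A B : Type*} [CommRing A] [Algebra ℂ A] [CommRing B] [Algebra ℂ B]

/-- The algebra `A` with the comultiplication `Δ`, the counit `ε` (both of them algebra
homomorphisms) and the grading `𝒜` is a graded connected bialgebra. -/
structure IsGradedConnectedBialgebra (Δ : A →ₐ[ℂ] A ⊗[ℂ] A) (ε : A →ₐ[ℂ] ℂ)
    (𝒜 : ℕ → Submodule ℂ A) : Prop where
  /-- `(Δ ⊗ id) ∘ Δ = (id ⊗ Δ) ∘ Δ` -/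
  coassoc : (Algebra.TensorProduct.assoc ℂ ℂ ℂ A A A).toAlgHom.comp
      ((Algebra.TensorProduct.map Δ (AlgHom.id ℂ A)).comp Δ) =
    (Algebra.TensorProduct.map (AlgHom.id ℂ A) Δ).comp Δ
  /-- `(ε ⊗ id) ∘ Δ = id` -/
  counit_left : (Algebra.TensorProduct.lid ℂ A).toAlgHom.comp
    ((Algebra.TensorProduct.map ε (AlgHom.id ℂ A)).comp Δ) = AlgHom.id ℂ A
  /-- `(id ⊗ ε) ∘ Δ = id` -/
  counit_right : (Algebra.TensorProduct.rid ℂ ℂ A).toAlgHom.comp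
    ((Algebra.TensorProduct.map (AlgHom.id ℂ A) ε).comp Δ) = AlgHom.id ℂ A
  /-- `1 ∈ 𝒜_0` and `𝒜_i 𝒜_j ⊆ 𝒜_{i+j}` -/
  gradedMonoid : SetLike.GradedMonoid 𝒜
  /-- `A = ⨁_m 𝒜_m` -/
  isInternal : DirectSum.IsInternal 𝒜
  /-- `Δ(𝒜_m) ⊆ ∑_{i+j=m} 𝒜_i ⊗ 𝒜_j` -/
  comul_mem : ∀ m, ∀ a ∈ 𝒜 m, Δ a ∈
    ⨆ p ∈ Finset.HasAntidiagonal.antidiagonal m,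
      LinearMap.range (TensorProduct.mapIncl (𝒜 p.1) (𝒜 p.2))
  /-- `ε(𝒜_m) = 0` for `m ≠ 0` -/
  counit_eq_zero : ∀ m, m ≠ 0 → ∀ a ∈ 𝒜 m, ε a = 0
  /-- `𝒜_0 = ℂ 1` -/
  connected : 𝒜 0 = ℂ ∙ (1 : A)

/-- The algebra homomorphism `φ : A → B` is a homomorphism of graded bialgebras. -/
structure IsGradedBialgebraHom (Δ : A →ₐ[ℂ] A ⊗[ℂ] A) (ε : A →ₐ[ℂ] ℂ) (𝒜 : ℕ → Submodule ℂ A)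
    (Δ' : B →ₐ[ℂ] B ⊗[ℂ] B) (ε' : B →ₐ[ℂ] ℂ) (ℬ : ℕ → Submodule ℂ B) (φ : A →ₐ[ℂ] B) : Prop where
  /-- `Δ' ∘ φ = (φ ⊗ φ) ∘ Δ` -/
  comul : Δ'.comp φ = (Algebra.TensorProduct.map φ φ).comp Δ
  /-- `ε' ∘ φ = ε` -/
  counit : ε'.comp φ = ε
  /-- `φ(𝒜_m) ⊆ ℬ_m` -/
  map_mem : ∀ m, ∀ a ∈ 𝒜 m, φ a ∈ ℬ m

/-- The convolution `χ₁ * χ₂ = (χ₁ ⊗ χ₂) ∘ Δ` of characters, i.e. of algebra homomorphisms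
`A → ℂ`: if `Δ(a) = ∑ a' ⊗ a''`, then `(χ₁ * χ₂)(a) = ∑ χ₁(a') χ₂(a'')`. -/
noncomputable def conv (Δ : A →ₐ[ℂ] A ⊗[ℂ] A) (χ₁ χ₂ : A →ₐ[ℂ] ℂ) : A →ₐ[ℂ] ℂ :=
  (Algebra.TensorProduct.productMap χ₁ χ₂).comp Δ

end

end NCHopf

namespace NCHopf

namespace NC

variable {n : ℕ}

@[ext] theorem ext {π σ : NC n} (h : ∀ i j, π.Rel i j ↔ σ.Rel i j) : π = σ :=
  Subtype.ext (Setoid.ext h)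

theorem top_rel (i j : Fin n) : (⊤ : NC n).Rel i j := trivial

theorem bot_rel {i j : Fin n} : (⊥ : NC n).Rel i j ↔ i = j := Iff.rfl

theorem noncrossing (π : NC n) {a b c d : Fin n} (h1 : a < b) (h2 : b < c) (h3 : c < d)
    (hac : π.Rel a c) (hbd : π.Rel b d) : π.Rel a b := π.2 a b c d h1 h2 h3 hac hbd

open Classical in
/-- The block of `π` containing `i`. -/
noncomputable def block (π : NC n) (i : Fin n) : Finset (Fin n) :=
  Finset.univ.filter fun j => π.Rel i j

theorem mem_block {π : NC n} {i j : Fin n} : j ∈ π.block i ↔ π.Rel i j := by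
  classical
  simp [block]

theorem mem_blocks {π : NC n} {W : Finset (Fin n)} : W ∈ π.blocks ↔ ∃ i, π.block i = W := by
  simp [blocks, block]

theorem block_mem_blocks (π : NC n) (i : Fin n) : π.block i ∈ π.blocks := mem_blocks.2 ⟨i, rfl⟩

theorem rel_of_mem_blocks {π : NC n} {W : Finset (Fin n)} (hW : W ∈ π.blocks) {i j : Fin n}
    (hi : i ∈ W) (hj : j ∈ W) : π.Rel i j := by
  obtain ⟨k, rfl⟩ := mem_blocks.1 hW
  exact (mem_block.1 hi).symm.trans (mem_block.1 hj)

theorem mem_of_rel {π : NC n} {W : Finset (Fin n)} (hW : W ∈ π.blocks) {i j : Fin n}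
    (hi : i ∈ W) (hij : π.Rel i j) : j ∈ W := by
  obtain ⟨k, rfl⟩ := mem_blocks.1 hW
  exact mem_block.2 ((mem_block.1 hi).trans hij)

theorem self_mem_block (π : NC n) (i : Fin n) : i ∈ π.block i := mem_block.2 (Rel.refl π i)

theorem block_eq {π : NC n} {W : Finset (Fin n)} (hW : W ∈ π.blocks) {i : Fin n} (hi : i ∈ W) :
    π.block i = W := by
  ext j
  exact ⟨fun h => mem_of_rel hW hi (mem_block.1 h),
    fun h => mem_block.2 (rel_of_mem_blocks hW hi h)⟩

theorem eq_of_mem_blocks {π : NC n} {W W' : Finset (Fin n)} (hW : W ∈ π.blocks)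
    (hW' : W' ∈ π.blocks) {i : Fin n} (hi : i ∈ W) (hi' : i ∈ W') : W = W' := by
  rw [← block_eq hW hi, ← block_eq hW' hi']

theorem nonempty_of_mem_blocks {π : NC n} {W : Finset (Fin n)} (hW : W ∈ π.blocks) :
    W.Nonempty := Finset.card_pos.1 (card_pos_of_mem_blocks hW)

theorem blocks_bot : (⊥ : NC n).blocks = Finset.univ.image fun i => {i} := by
  ext W
  simp only [mem_blocks, Finset.mem_image, Finset.mem_univ, true_and]
  refine exists_congr fun i => ?_
  have : (⊥ : NC n).block i = {i} := by
    ext j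
    rw [mem_block, bot_rel, Finset.mem_singleton, eq_comm]
  rw [this]

theorem blocks_top (hn : 0 < n) : (⊤ : NC n).blocks = {Finset.univ} := by
  have h : ∀ i, (⊤ : NC n).block i = Finset.univ := fun i => by
    ext j
    simp [mem_block, top_rel]
  ext W
  simp only [mem_blocks, h, Finset.mem_singleton]
  exact ⟨fun ⟨_, h⟩ => h.symm, fun h => ⟨⟨0, hn⟩, h.symm⟩⟩

/-! ### Restriction -/

/-- The increasing enumeration of `W`. -/
abbrev emb (W : Finset (Fin n)) : Fin W.card ↪o Fin n := W.orderEmbOfFin rfl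

theorem emb_mem (W : Finset (Fin n)) (a : Fin W.card) : emb W a ∈ W :=
  Finset.orderEmbOfFin_mem _ _ _

theorem exists_emb_eq {W : Finset (Fin n)} {i : Fin n} (hi : i ∈ W) : ∃ a, emb W a = i := by
  have : i ∈ Set.range (emb W) := by rw [Finset.range_orderEmbOfFin]; exact hi
  exact this

theorem restrict_rel {π : NC n} {W : Finset (Fin n)} {a b : Fin W.card} :
    (π.restrict W).Rel a b ↔ π.Rel (emb W a) (emb W b) := Iff.rfl

theorem restrict_mono {π σ : NC n} (h : π ≤ σ) (W : Finset (Fin n)) :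
    π.restrict W ≤ σ.restrict W := le_iff.2 fun _ _ hab => le_iff.1 h _ _ hab

theorem restrict_self {σ : NC n} {W : Finset (Fin n)} (hW : W ∈ σ.blocks) :
    σ.restrict W = ⊤ := by
  ext a b
  exact ⟨fun _ => top_rel _ _, fun _ => rel_of_mem_blocks hW (emb_mem W a) (emb_mem W b)⟩

theorem bot_restrict (W : Finset (Fin n)) : (⊥ : NC n).restrict W = ⊥ := by
  ext a b
  rw [restrict_rel, bot_rel, bot_rel, (emb W).injective.eq_iff]

theorem eq_of_restrict_eq {π σ ρ : NC n} (hπ : π ≤ σ) (hρ : ρ ≤ σ)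
    (h : ∀ W ∈ σ.blocks, π.restrict W = ρ.restrict W) : π = ρ := by
  have key : ∀ {i j}, σ.Rel i j → (π.Rel i j ↔ ρ.Rel i j) := by
    intro i j hij
    obtain ⟨a, ha⟩ := exists_emb_eq (σ.self_mem_block i)
    obtain ⟨b, hb⟩ := exists_emb_eq (mem_block.2 hij)
    have := congrArg (fun τ : NC _ => τ.Rel a b) (h _ (σ.block_mem_blocks i))
    simp only [restrict_rel, ha, hb] at this
    exact iff_of_eq this
  ext i j
  exact ⟨fun h => (key (le_iff.1 hπ _ _ h)).1 h, fun h => (key (le_iff.1 hρ _ _ h)).2 h⟩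

theorem apply_restrict_eq {R : Type*} (F : ∀ m, NC m → R) (π : NC n) (W : Finset (Fin n)) {m : ℕ}
    (τ : NC m) (f : Fin m ↪o Fin n) (hf : ∀ i, i ∈ W ↔ ∃ a, f a = i)
    (hτ : ∀ a b, τ.Rel a b ↔ π.Rel (f a) (f b)) : F m τ = F _ (π.restrict W) := by
  have hW : W = Finset.univ.map f.toEmbedding := by
    ext i
    simp [hf]
  have hm : m = W.card := by simp [hW]
  subst hm
  have hf' : f = emb W := Finset.orderEmbOfFin_unique' rfl fun a => (hf _).2 ⟨a, rfl⟩
  congr 1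
  ext a b
  rw [hτ, restrict_rel, hf']

theorem apply_restrict_univ {R : Type*} (F : ∀ m, NC m → R) (π : NC n) :
    F _ (π.restrict Finset.univ) = F n π :=
  (apply_restrict_eq F π Finset.univ π (OrderIso.refl _).toOrderEmbedding (by simp)
    fun _ _ => Iff.rfl).symm

theorem apply_restrict_restrict {R : Type*} (F : ∀ m, NC m → R) (π : NC n) (W : Finset (Fin n))
    (U : Finset (Fin W.card)) :
    F _ ((π.restrict W).restrict U) = F _ (π.restrict (U.map (emb W).toEmbedding)) := by
  refine apply_restrict_eq F π _ _ ((emb U).trans (emb W)) (fun i => ?_) fun _ _ => Iff.rfl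
  simp only [Finset.mem_map]
  constructor
  · rintro ⟨a, ha, rfl⟩
    obtain ⟨b, rfl⟩ := exists_emb_eq ha
    exact ⟨b, rfl⟩
  · rintro ⟨a, rfl⟩
    exact ⟨_, emb_mem U a, rfl⟩

/-- The blocks of `ρ ≤ σ` are the blocks of the restrictions of `ρ` to the blocks of `σ`. -/
theorem blocks_eq_biUnion {ρ σ : NC n} (h : ρ ≤ σ) : ρ.blocks = σ.blocks.biUnion fun W =>
    (ρ.restrict W).blocks.map (Finset.mapEmbedding (emb W).toEmbedding).toEmbedding := by
  have key : ∀ (i : Fin n) (W) (_ : W ∈ σ.blocks) (a : Fin W.card), emb W a = i →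
      ρ.block i = ((ρ.restrict W).block a).map (emb W).toEmbedding := by
    rintro i W hW a rfl
    ext j
    rw [mem_block, Finset.mem_map]
    constructor
    · intro hj
      obtain ⟨b, rfl⟩ := exists_emb_eq (mem_of_rel hW (emb_mem W a) (le_iff.1 h _ _ hj))
      exact ⟨b, mem_block.2 hj, rfl⟩
    · rintro ⟨b, hb, rfl⟩
      exact restrict_rel.1 (mem_block.1 hb)
  ext V
  simp only [Finset.mem_biUnion, Finset.mem_map]
  constructor
  · intro hV
    obtain ⟨i, rfl⟩ := mem_blocks.1 hV
    obtain ⟨a, ha⟩ := exists_emb_eq (σ.self_mem_block i)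
    exact ⟨_, σ.block_mem_blocks i, _, block_mem_blocks _ a,
      (key i _ (σ.block_mem_blocks i) a ha).symm⟩
  · rintro ⟨W, hW, U, hU, rfl⟩
    obtain ⟨a, rfl⟩ := mem_blocks.1 hU
    refine mem_blocks.2 ⟨emb W a, ?_⟩
    exact key _ W hW a rfl

@[to_additive]
theorem prod_blocks_of_le {M : Type*} [CommMonoid M] {ρ σ : NC n} (h : ρ ≤ σ)
    (f : Finset (Fin n) → M) : ∏ U ∈ ρ.blocks, f U =
      ∏ W ∈ σ.blocks, ∏ U ∈ (ρ.restrict W).blocks, f (U.map (emb W).toEmbedding) := by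
  rw [blocks_eq_biUnion h, Finset.prod_biUnion]
  · exact Finset.prod_congr rfl fun W _ => by
      rw [Finset.prod_map]
      rfl
  · intro W hW W' hW' hne
    rw [Function.onFun, Finset.disjoint_left]
    intro V hV hV'
    obtain ⟨U, hU, rfl⟩ := Finset.mem_map.1 hV
    obtain ⟨U', hU', h'⟩ := Finset.mem_map.1 hV'
    obtain ⟨a, ha⟩ := nonempty_of_mem_blocks hU
    have h1 : emb W a ∈ U'.map (emb W').toEmbedding := by
      have : emb W a ∈ U.map (emb W).toEmbedding := Finset.mem_map.2 ⟨a, ha, rfl⟩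
      exact (Finset.ext_iff.1 h' _).2 this
    obtain ⟨b, hb, hb'⟩ := Finset.mem_map.1 h1
    exact hne (eq_of_mem_blocks hW hW' (emb_mem W a) (hb' ▸ emb_mem W' b))

theorem prod_restrict {M : Type*} [CommMonoid M] {ρ σ : NC n} (h : ρ ≤ σ) (F : ∀ m, NC m → M)
    (π : NC n) : ∏ W ∈ σ.blocks, ∏ U ∈ (ρ.restrict W).blocks, F _ ((π.restrict W).restrict U) =
      ∏ U ∈ ρ.blocks, F _ (π.restrict U) := by
  rw [prod_blocks_of_le h]
  exact Finset.prod_congr rfl fun W _ => Finset.prod_congr rfl fun U _ =>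
    apply_restrict_restrict F π W U

/-! ### Gluing -/

/-- The non-crossing partition `ρ ≤ σ` with prescribed restrictions to the blocks of `σ`. -/
def glue (σ : NC n) (f : ∀ W : Finset (Fin n), NC W.card) : NC n :=
  ⟨{ r := fun i j => ∃ W ∈ σ.blocks, ∃ a b, emb W a = i ∧ emb W b = j ∧ (f W).Rel a b
     iseqv :=
      { refl := fun i => by
          obtain ⟨a, ha⟩ := exists_emb_eq (σ.self_mem_block i)
          exact ⟨_, σ.block_mem_blocks i, a, a, ha, ha, Rel.refl _ a⟩
        symm := fun ⟨W, hW, a, b, ha, hb, h⟩ => ⟨W, hW, b, a, hb, ha, h.symm⟩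
        trans := by
          rintro i j k ⟨W, hW, a, b, rfl, rfl, h⟩ ⟨W', hW', b', c, hb, rfl, h'⟩
          obtain rfl := eq_of_mem_blocks hW hW' (emb_mem W b) (hb ▸ emb_mem W' b')
          obtain rfl := (emb W).injective hb
          exact ⟨W, hW, a, c, rfl, rfl, h.trans h'⟩ } }, by
    rintro i j k l h1 h2 h3 ⟨W, hW, a, c, rfl, rfl, h⟩ ⟨W', hW', b, d, rfl, rfl, h'⟩
    have hrel := σ.noncrossing (a := emb W a) (b := emb W' b) (c := emb W c) (d := emb W' d)
      h1 h2 h3 (rel_of_mem_blocks hW (emb_mem _ _) (emb_mem _ _))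
      (rel_of_mem_blocks hW' (emb_mem _ _) (emb_mem _ _))
    obtain rfl := eq_of_mem_blocks hW hW' (mem_of_rel hW (emb_mem W a) hrel) (emb_mem W' b)
    have e1 : a < b := (emb W).lt_iff_lt.1 h1
    have e2 : b < c := (emb W).lt_iff_lt.1 h2
    have e3 : c < d := (emb W).lt_iff_lt.1 h3
    exact ⟨W, hW, a, b, rfl, rfl, (f W).noncrossing e1 e2 e3 h h'⟩⟩

theorem glue_rel {σ : NC n} {f : ∀ W : Finset (Fin n), NC W.card} {i j : Fin n} :
    (glue σ f).Rel i j ↔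
      ∃ W ∈ σ.blocks, ∃ a b, emb W a = i ∧ emb W b = j ∧ (f W).Rel a b := Iff.rfl

theorem glue_le (σ : NC n) (f : ∀ W : Finset (Fin n), NC W.card) : glue σ f ≤ σ := by
  rw [le_iff]
  rintro i j ⟨W, hW, a, b, rfl, rfl, -⟩
  exact rel_of_mem_blocks hW (emb_mem _ _) (emb_mem _ _)

theorem glue_restrict (σ : NC n) (f : ∀ W : Finset (Fin n), NC W.card) {W : Finset (Fin n)}
    (hW : W ∈ σ.blocks) : (glue σ f).restrict W = f W := by
  ext a b
  rw [restrict_rel, glue_rel]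
  constructor
  · rintro ⟨W', hW', a', b', ha, hb, h⟩
    obtain rfl := eq_of_mem_blocks hW hW' (emb_mem W a) (ha ▸ emb_mem W' a')
    obtain rfl := (emb W).injective ha
    obtain rfl := (emb W).injective hb
    exact h
  · exact fun h => ⟨W, hW, a, b, rfl, rfl, h⟩

theorem restrict_le_iff {π ρ σ : NC n} (hπ : π ≤ σ) :
    (∀ W ∈ σ.blocks, π.restrict W ≤ ρ.restrict W) ↔ π ≤ ρ := by
  refine ⟨fun h => le_iff.2 fun i j hij => ?_, fun h W _ => restrict_mono h W⟩
  obtain ⟨a, ha⟩ := exists_emb_eq (σ.self_mem_block i)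
  obtain ⟨b, hb⟩ := exists_emb_eq (mem_block.2 (le_iff.1 hπ _ _ hij))
  have := le_iff.1 (h _ (σ.block_mem_blocks i)) a b
  rw [restrict_rel, restrict_rel, ha, hb] at this
  exact this hij

/-- The interval `[π, σ]` is the product of the intervals `[π_W, 1]`, `W ∈ σ`. -/
theorem prod_sum_Ici {R : Type*} [CommSemiring R] {π σ : NC n} (hπ : π ≤ σ)
    (H : ∀ W : Finset (Fin n), NC W.card → R) :
    ∏ W ∈ σ.blocks, ∑ ρ ∈ Finset.Ici (π.restrict W), H W ρ =
      ∑ ρ ∈ Finset.Icc π σ, ∏ W ∈ σ.blocks, H W (ρ.restrict W) := by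
  classical
  rw [← Finset.prod_coe_sort, Finset.prod_univ_sum]
  symm
  refine Finset.sum_bij' (fun ρ _ W => ρ.restrict W.1)
    (fun f _ => glue σ fun W => if h : W ∈ σ.blocks then f ⟨W, h⟩ else ⊤) ?_ ?_ ?_ ?_ ?_
  · intro ρ hρ
    rw [Fintype.mem_piFinset]
    exact fun W => Finset.mem_Ici.2 (restrict_mono (Finset.mem_Icc.1 hρ).1 _)
  · intro f hf
    rw [Fintype.mem_piFinset] at hf
    refine Finset.mem_Icc.2 ⟨(restrict_le_iff hπ).1 fun W hW => ?_, glue_le _ _⟩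
    rw [glue_restrict _ _ hW, dif_pos hW]
    exact Finset.mem_Ici.1 (hf ⟨W, hW⟩)
  · intro ρ hρ
    refine eq_of_restrict_eq (glue_le _ _) (Finset.mem_Icc.1 hρ).2 fun W hW => ?_
    rw [glue_restrict _ _ hW, dif_pos hW]
  · intro f hf
    funext W
    exact (glue_restrict _ _ W.2).trans (dif_pos W.2)
  · intro ρ _
    exact (Finset.prod_coe_sort σ.blocks fun W => H W (ρ.restrict W)).symm

theorem exists_forall_le {P : Fin n → Prop} (h : ∃ i, P i) : ∃ i, P i ∧ ∀ j, P j → j ≤ i := by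
  classical
  obtain ⟨i, hi⟩ := h
  obtain ⟨k, hk, hmax⟩ := (Finset.univ.filter P).exists_max_image id ⟨i, by simpa using hi⟩
  exact ⟨k, by simpa using hk, fun j hj => hmax j (by simpa using hj)⟩

theorem exists_forall_ge {P : Fin n → Prop} (h : ∃ i, P i) : ∃ i, P i ∧ ∀ j, P j → i ≤ j := by
  classical
  obtain ⟨i, hi⟩ := h
  obtain ⟨k, hk, hmin⟩ := (Finset.univ.filter P).exists_min_image id ⟨i, by simpa using hi⟩
  exact ⟨k, by simpa using hk, fun j hj => hmin j (by simpa using hj)⟩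

/-! ### The Kreweras complement -/

theorem kr_rel {π : NC n} {i j : Fin n} : π.kr.Rel i j ↔ ∀ a b, π.Rel a b →
    (a ∈ Set.Ioc (min i j) (max i j) ↔ b ∈ Set.Ioc (min i j) (max i j)) := Iff.rfl

theorem kr_rel_of_le {π : NC n} {i j : Fin n} (hij : i ≤ j) : π.kr.Rel i j ↔
    ∀ a b, π.Rel a b → i < a → a ≤ j → i < b ∧ b ≤ j := by
  rw [kr_rel, min_eq_left hij, max_eq_right hij]
  exact ⟨fun h a b hab h1 h2 => (h a b hab).1 ⟨h1, h2⟩,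
    fun h a b hab => ⟨fun h' => h a b hab h'.1 h'.2, fun h' => h b a hab.symm h'.1 h'.2⟩⟩

theorem kr_antitone {π σ : NC n} (h : π ≤ σ) : σ.kr ≤ π.kr :=
  le_iff.2 fun _ _ hij a b hab => hij a b (le_iff.1 h _ _ hab)

/-- `π` is determined by its Kreweras complement. -/
theorem rel_iff_kr {π : NC n} {a b : Fin n} (hab : a ≤ b) : π.Rel a b ↔
    ∀ i j, π.kr.Rel i j → a ≤ i → i < b → a ≤ j ∧ j < b := by
  constructor
  · intro h i j hij h1 h2
    have := hij a b h
    simp only [Set.mem_Ioc, min_lt_iff, le_max_iff] at this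
    omega
  · intro h
    by_contra hn
    have hab' : a < b := lt_of_le_of_ne hab fun e => hn (e ▸ Rel.refl π a)
    have hne : ∀ {x y}, π.Rel a x → ¬ π.Rel a y → x ≠ y := fun hx hy e => hy (e ▸ hx)
    obtain ⟨c, ⟨hc, hcb⟩, hmax⟩ := exists_forall_le (P := fun x => π.Rel a x ∧ x < b)
      ⟨a, Rel.refl π a, hab'⟩
    have hac : a ≤ c := hmax a ⟨Rel.refl π a, hab'⟩
    by_cases hex : ∃ x, π.Rel a x ∧ b < x
    · obtain ⟨d, ⟨hd, hbd⟩, hmin⟩ := exists_forall_ge hex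
      have hkr : π.kr.Rel c ⟨d - 1, by omega⟩ := by
        rw [kr_rel_of_le (by rw [Fin.le_def]; simp only; omega)]
        intro x y hxy h1 h2
        have h2' : x < d := by rw [Fin.le_def] at h2; simp only at h2; omega
        have hx : ¬ π.Rel a x := fun hx => by
          rcases lt_trichotomy x b with hlt | rfl | hlt
          · exact absurd (hmax x ⟨hx, hlt⟩) (not_le.2 h1)
          · exact hn hx
          · exact absurd (hmin x ⟨hx, hlt⟩) (not_le.2 h2')
        have hy : ¬ π.Rel a y := fun hy => hx (hy.trans hxy.symm)
        have e1 := hne hc hy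
        have e2 := hne hd hy
        have hcd := hc.symm.trans hd
        by_contra hcon
        have hcon' : y < c ∨ d < y := by
          rw [Fin.le_def] at hcon
          simp only at hcon
          omega
        rcases hcon' with hlt | hlt
        · exact hy (hc.trans (π.noncrossing hlt h1 h2' hxy.symm hcd).symm)
        · exact hx (hc.trans (π.noncrossing h1 h2' hlt hcd hxy))
      have := (h _ _ hkr hac hcb).2
      rw [Fin.lt_def] at this
      simp only at this
      omega
    · have hall : ∀ x, π.Rel a x → x ≤ c := fun x hx => hmax x ⟨hx, by
        rcases lt_trichotomy x b with hlt | rfl | hlt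
        · exact hlt
        · exact absurd hx hn
        · exact absurd ⟨x, hx, hlt⟩ hex⟩
      obtain ⟨m, hm, hmin⟩ := exists_forall_ge (P := fun x => π.Rel a x) ⟨a, Rel.refl π a⟩
      have hma := hmin a (Rel.refl π a)
      have hmc := hm.symm.trans hc
      by_cases hm0 : (m : ℕ) = 0
      · have hkr : π.kr.Rel c ⟨n - 1, by omega⟩ := by
          rw [kr_rel_of_le (by rw [Fin.le_def]; simp only; omega)]
          intro x y hxy h1 _
          refine ⟨?_, by rw [Fin.le_def]; simp only; omega⟩
          have hx : ¬ π.Rel a x := fun hx => absurd (hall x hx) (not_le.2 h1)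
          have hy : ¬ π.Rel a y := fun hy => hx (hy.trans hxy.symm)
          have e1 := hne hc hy
          have e2 := hne hm hy
          by_contra hcon
          exact hy (hm.trans (π.noncrossing (show m < y by omega) (show y < c by omega)
            (show c < x by omega) hmc hxy.symm))
        have := (h _ _ hkr hac hcb).2
        rw [Fin.lt_def] at this
        simp only at this
        omega
      · have hkr : π.kr.Rel ⟨m - 1, by omega⟩ c := by
          rw [kr_rel_of_le (by rw [Fin.le_def]; simp only; omega)]
          intro x y hxy h1 h2
          rw [Fin.lt_def] at h1 ⊢
          simp only at h1 ⊢
          by_cases hy : π.Rel a y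
          · have := hmin y hy
            exact ⟨by omega, hall y hy⟩
          have hx : ¬ π.Rel a x := fun hx => hy (hx.trans hxy)
          have e1 := hne hc hy
          have e2 := hne hm hy
          have e3 := hne hc hx
          have e4 := hne hm hx
          by_contra hcon
          have hcon' : y < m ∨ c < y := by omega
          rcases hcon' with hlt | hlt
          · exact hy (hm.trans (π.noncrossing hlt (show m < x by omega) (show x < c by omega)
              hxy.symm hmc).symm)
          · exact hx (hm.trans (π.noncrossing (show m < x by omega) (show x < c by omega) hlt
              hmc hxy))
        have := (h _ _ hkr.symm hac hcb).1
        rw [Fin.le_def] at this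
        simp only at this
        omega

theorem le_of_kr_le {π σ : NC n} (h : σ.kr ≤ π.kr) : π ≤ σ := by
  have key : ∀ i j, i ≤ j → π.Rel i j → σ.Rel i j := fun i j hij hr =>
    (rel_iff_kr hij).2 fun k l hkl => (rel_iff_kr hij).1 hr k l (le_iff.1 h _ _ hkl)
  rw [le_iff]
  intro i j hr
  rcases le_total i j with hij | hij
  · exact key i j hij hr
  · exact (key j i hij hr.symm).symm

theorem kr_injective : Function.Injective (kr : NC n → NC n) := fun _ _ h =>
  le_antisymm (le_of_kr_le h.ge) (le_of_kr_le h.le)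

theorem kr_bijective : Function.Bijective (kr : NC n → NC n) :=
  Finite.injective_iff_bijective.1 kr_injective

theorem kr_top : (⊤ : NC n).kr = ⊥ := by
  obtain ⟨τ, hτ⟩ := kr_bijective.2 (⊥ : NC n)
  exact le_bot_iff.1 (hτ ▸ kr_antitone le_top)

theorem kr_bot : (⊥ : NC n).kr = ⊤ := by
  obtain ⟨τ, hτ⟩ := kr_bijective.2 (⊤ : NC n)
  exact top_le_iff.1 (hτ ▸ kr_antitone bot_le)

/-! ### The number of blocks -/

open Classical in
theorem card_blocks_eq_card_min (π : NC n) :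
    π.blocks.card = (Finset.univ.filter fun i => ∀ j, π.Rel i j → i ≤ j).card := by
  symm
  refine Finset.card_bij (fun i _ => π.block i) (fun i _ => π.block_mem_blocks i) ?_ ?_
  · intro i hi j hj hij
    simp only [Finset.mem_filter, Finset.mem_univ, true_and] at hi hj
    have h : π.Rel i j := mem_block.1 (hij ▸ π.self_mem_block j)
    exact le_antisymm (hi j h) (hj i h.symm)
  · intro W hW
    obtain ⟨i, rfl⟩ := mem_blocks.1 hW
    obtain ⟨m, hm, hmin⟩ := exists_forall_ge (P := fun x => π.Rel i x) ⟨i, Rel.refl π i⟩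
    refine ⟨m, ?_, block_eq (π.block_mem_blocks i) (mem_block.2 hm)⟩
    simpa using fun j hj => hmin j (hm.trans hj)

open Classical in
theorem card_blocks_eq_card_max (π : NC n) :
    π.blocks.card = (Finset.univ.filter fun i => ∀ j, π.Rel i j → j ≤ i).card := by
  symm
  refine Finset.card_bij (fun i _ => π.block i) (fun i _ => π.block_mem_blocks i) ?_ ?_
  · intro i hi j hj hij
    simp only [Finset.mem_filter, Finset.mem_univ, true_and] at hi hj
    have h : π.Rel i j := mem_block.1 (hij ▸ π.self_mem_block j)
    exact le_antisymm (hj i h.symm) (hi j h)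
  · intro W hW
    obtain ⟨i, rfl⟩ := mem_blocks.1 hW
    obtain ⟨m, hm, hmax⟩ := exists_forall_le (P := fun x => π.Rel i x) ⟨i, Rel.refl π i⟩
    refine ⟨m, ?_, block_eq (π.block_mem_blocks i) (mem_block.2 hm)⟩
    simpa using fun j hj => hmax j (hm.trans hj)

/-- A point `j'` other than the last one is the largest in its block of `Kr(π)` iff `j + 1` is not
the smallest in its block of `π`. -/
theorem kr_max_iff {π : NC n} {i j : Fin n} (hij : (j : ℕ) = i + 1) :
    (∀ k, π.kr.Rel i k → k ≤ i) ↔ ¬ ∀ k, π.Rel j k → j ≤ k := by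
  constructor
  · intro h hmin
    obtain ⟨m, hm, hmax⟩ := exists_forall_le (P := fun x => π.Rel j x) ⟨j, Rel.refl π j⟩
    have hjm := hmax j (Rel.refl π j)
    have hkr : π.kr.Rel i m := by
      rw [kr_rel_of_le (by omega)]
      intro x y hxy h1 h2
      by_cases hy : π.Rel j y
      · have e1 := hmax y hy
        have e2 := hmin y hy
        exact ⟨by omega, e1⟩
      have hx : ¬ π.Rel j x := fun hx => hy (hx.trans hxy)
      have e1 : y ≠ j := fun e => hy (e ▸ Rel.refl π j)
      have e2 : y ≠ m := fun e => hy (e ▸ hm)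
      have e3 : x ≠ j := fun e => hx (e ▸ Rel.refl π j)
      have e4 : x ≠ m := fun e => hx (e ▸ hm)
      by_contra hcon
      have hcon' : y < j ∨ m < y := by omega
      rcases hcon' with hlt | hlt
      · exact hy (π.noncrossing hlt (show j < x by omega) (show x < m by omega) hxy.symm hm).symm
      · exact hx (π.noncrossing (show j < x by omega) (show x < m by omega) hlt hm hxy)
    have := h m hkr
    omega
  · intro h k hk
    by_contra hlt
    push Not at h hlt
    obtain ⟨l, hl, hlj⟩ := h
    have := (kr_rel_of_le hlt.le).1 hk j l hl (by omega) (by omega)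
    omega

theorem card_blocks_add_card_blocks_kr (π : NC n) (hn : 0 < n) :
    π.blocks.card + π.kr.blocks.card = n + 1 := by
  classical
  obtain ⟨m, rfl⟩ : ∃ m, n = m + 1 := ⟨n - 1, by omega⟩
  rw [card_blocks_eq_card_min, card_blocks_eq_card_max, Finset.card_filter, Finset.card_filter,
    Fin.sum_univ_succ, Fin.sum_univ_castSucc, if_pos fun j _ => Fin.zero_le j,
    if_pos fun j _ => Fin.le_last j]
  have : ∀ i : Fin m, (if ∀ j, π.Rel i.succ j → i.succ ≤ j then 1 else 0) +
      (if ∀ j, π.kr.Rel i.castSucc j → j ≤ i.castSucc then 1 else 0) = 1 := by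
    intro i
    have := kr_max_iff (π := π) (i := i.castSucc) (j := i.succ) (by simp)
    by_cases h : ∀ j, π.Rel i.succ j → i.succ ≤ j
    · rw [if_pos h, if_neg fun h' => this.1 h' h]
    · rw [if_neg h, if_pos (this.2 h)]
  have hsum := Finset.sum_congr rfl fun i (_ : i ∈ Finset.univ) => this i
  rw [Finset.sum_add_distrib] at hsum
  simp only [Finset.sum_const, Finset.card_univ, Fintype.card_fin, smul_eq_mul, mul_one] at hsum
  omega

/-! ### The relative Kreweras complement -/

/-- The relative Kreweras complement: the restriction to each block `W` of `σ` is the Kreweras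
complement of `π_W`. -/
def krel (π σ : NC n) : NC n :=
  ⟨{ r := fun i j => σ.Rel i j ∧ ∀ a b, π.Rel a b → σ.Rel i a → σ.Rel i b →
        (a ∈ Set.Ioc (min i j) (max i j) ↔ b ∈ Set.Ioc (min i j) (max i j))
     iseqv :=
      { refl := fun i => ⟨Rel.refl σ i, fun a b _ => by simp⟩
        symm := fun {i j} h => ⟨h.1.symm, fun a b hab ha hb => by
          rw [min_comm, max_comm]
          exact h.2 a b hab (h.1.trans ha) (h.1.trans hb)⟩
        trans := fun {i j k} h h' => ⟨h.1.trans h'.1, fun a b hab ha hb => by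
          have h1 := h.2 a b hab ha hb
          have h2 := h'.2 a b hab (h.1.symm.trans ha) (h.1.symm.trans hb)
          simp only [Set.mem_Ioc, min_lt_iff, le_max_iff] at h1 h2 ⊢
          omega⟩ } },
    fun i j k l h1 h2 h3 hik hjl => by
      have h1' : i < j := h1
      have h2' : j < k := h2
      have h3' : k < l := h3
      have hij := σ.noncrossing h1' h2' h3' hik.1 hjl.1
      refine ⟨hij, fun a b hab ha hb => ?_⟩
      have e1 := hik.2 a b hab ha hb
      have e2 := hjl.2 a b hab (hij.symm.trans ha) (hij.symm.trans hb)
      simp only [Set.mem_Ioc, min_lt_iff, le_max_iff] at e1 e2 ⊢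
      omega⟩

theorem krel_rel {π σ : NC n} {i j : Fin n} : (krel π σ).Rel i j ↔ σ.Rel i j ∧
    ∀ a b, π.Rel a b → σ.Rel i a → σ.Rel i b →
      (a ∈ Set.Ioc (min i j) (max i j) ↔ b ∈ Set.Ioc (min i j) (max i j)) := Iff.rfl

theorem krel_le (π σ : NC n) : krel π σ ≤ σ := le_iff.2 fun _ _ h => h.1

theorem krel_restrict (π : NC n) {σ : NC n} {W : Finset (Fin n)} (hW : W ∈ σ.blocks) :
    (krel π σ).restrict W = (π.restrict W).kr := by
  have hmem : ∀ a i j : Fin W.card, emb W a ∈ Set.Ioc (min (emb W i) (emb W j))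
      (max (emb W i) (emb W j)) ↔ a ∈ Set.Ioc (min i j) (max i j) := by
    intro a i j
    simp only [Set.mem_Ioc, min_lt_iff, le_max_iff, OrderEmbedding.lt_iff_lt,
      OrderEmbedding.le_iff_le]
  ext i j
  rw [restrict_rel, krel_rel, kr_rel]
  constructor
  · intro h a b hab
    rw [← hmem, ← hmem]
    exact h.2 _ _ hab (rel_of_mem_blocks hW (emb_mem _ _) (emb_mem _ _))
      (rel_of_mem_blocks hW (emb_mem _ _) (emb_mem _ _))
  · intro h
    refine ⟨rel_of_mem_blocks hW (emb_mem _ _) (emb_mem _ _), fun a b hab ha hb => ?_⟩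
    obtain ⟨a, rfl⟩ := exists_emb_eq (mem_of_rel hW (emb_mem W i) ha)
    obtain ⟨b, rfl⟩ := exists_emb_eq (mem_of_rel hW (emb_mem W i) hb)
    rw [hmem, hmem]
    exact h a b hab

theorem krel_le_kr {π σ : NC n} (h : π ≤ σ) : krel π σ ≤ π.kr := by
  rw [le_iff]
  have key : ∀ i j, i ≤ j → (krel π σ).Rel i j → π.kr.Rel i j := by
    intro i j hij hr
    obtain ⟨hs, hr⟩ := hr
    rw [min_eq_left hij, max_eq_right hij] at hr
    rw [kr_rel_of_le hij]
    intro x y hxy h1 h2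
    have hxy' := le_iff.1 h _ _ hxy
    by_cases hx : σ.Rel i x
    · exact (hr x y hxy hx (hx.trans hxy')).1 ⟨h1, h2⟩
    have hy : ¬ σ.Rel i y := fun hy => hx (hy.trans hxy'.symm)
    have e1 : x ≠ j := fun e => hx (e ▸ hs)
    have e2 : y ≠ j := fun e => hy (e ▸ hs)
    have e3 : y ≠ i := fun e => hy (e ▸ Rel.refl σ i)
    by_contra hcon
    have hcon' : y < i ∨ j < y := by omega
    rcases hcon' with hlt | hlt
    · exact hy (σ.noncrossing hlt h1 (show x < j by omega) hxy'.symm hs).symm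
    · exact hx (σ.noncrossing h1 (show x < j by omega) hlt hs hxy')
  intro i j hr
  rcases le_total i j with hij | hij
  · exact key i j hij hr
  · exact (key j i hij hr.symm).symm

theorem krel_krel_kr {π σ : NC n} (h : π ≤ σ) : krel (krel π σ) π.kr = σ.kr := by
  have key : ∀ i j, i ≤ j → ((krel (krel π σ) π.kr).Rel i j ↔ σ.kr.Rel i j) := by
    intro i j hij
    constructor
    · intro hr
      obtain ⟨hk, hr⟩ := hr
      rw [min_eq_left hij, max_eq_right hij] at hr
      have hk' := (kr_rel_of_le hij).1 hk
      rw [kr_rel_of_le hij]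
      by_contra hcon
      push Not at hcon
      obtain ⟨x, y, hxy, hx1, hx2, hy⟩ := hcon
      obtain ⟨a, ⟨ha1, ha2, b, hab, hb⟩, hmax⟩ := exists_forall_le
        (P := fun x => i < x ∧ x ≤ j ∧ ∃ y, σ.Rel x y ∧ ¬ (i < y ∧ y ≤ j))
        ⟨x, hx1, hx2, y, hxy, fun h' => absurd h'.2 (not_le.2 (hy h'.1))⟩
      have haj : π.kr.Rel a j := by
        rw [kr_rel_of_le ha2]
        intro u v huv hu1 hu2
        have huv' := le_iff.1 h _ _ huv
        by_contra hcon
        have hv := hk' u v huv (by omega) hu2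
        by_cases hav : σ.Rel a v
        · exact absurd (hmax u ⟨by omega, hu2, b, huv'.trans (hav.symm.trans hab), hb⟩)
            (not_le.2 hu1)
        have hva : v ≠ a := fun e => hav (e ▸ Rel.refl σ a)
        have hbu : b ≠ u := fun e => hb (e ▸ ⟨by omega, hu2⟩)
        have hbv : b ≠ v := fun e => hav (e ▸ hab)
        have hb' : b < v ∨ u < b := by omega
        rcases hb' with hlt | hlt
        · exact hav (hab.trans (σ.noncrossing hlt (show v < a by omega) hu1 hab.symm huv'.symm))
        · exact hav (σ.noncrossing (show v < a by omega) hu1 hlt huv'.symm hab).symm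
      have hia : π.kr.Rel i a := hk.trans haj.symm
      have hfin : ∀ c, (krel π σ).Rel a c → (i < c ∧ c ≤ j) := fun c hc =>
        (hr a c hc hia (hia.trans (le_iff.1 (krel_le_kr h) _ _ hc))).1 ⟨ha1, ha2⟩
      have hamax : ∀ u, σ.Rel a u → i < u → u ≤ j → u ≤ a := fun u hu h1 h2 =>
        hmax u ⟨h1, h2, b, hu.symm.trans hab, hb⟩
      by_cases hex : ∃ c, σ.Rel a c ∧ c ≤ i
      · obtain ⟨c, ⟨hc, hci⟩, hcmax⟩ := exists_forall_le hex
        have : (krel π σ).Rel c a := by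
          refine ⟨hc.symm, ?_⟩
          have hside : ∀ u v, π.Rel u v → σ.Rel c u → u ∈ Set.Ioc c a → v ∈ Set.Ioc c a := by
            intro u v huv hu hmem
            have hau := hc.trans hu
            have hiu : i < u := by
              by_contra hle
              exact absurd (hcmax u ⟨hau, by omega⟩) (not_le.2 hmem.1)
            have huj := hmem.2.trans ha2
            have hv := hk' u v huv hiu huj
            exact ⟨by omega, hamax v (hau.trans (le_iff.1 h _ _ huv)) hv.1 hv.2⟩
          have hca : c ≤ a := by omega
          rw [min_eq_left hca, max_eq_right hca]
          exact fun u v huv hu hv => ⟨hside u v huv hu, hside v u huv.symm hv⟩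
        have := hfin c this.symm
        omega
      · obtain ⟨c, hc, hcmax⟩ := exists_forall_le (P := fun x => σ.Rel a x) ⟨a, Rel.refl σ a⟩
        have hjc : j < c := by
          have := hcmax b hab
          by_contra hle
          exact hex ⟨b, hab, by omega⟩
        have : (krel π σ).Rel a c := by
          refine ⟨hc, ?_⟩
          have hside : ∀ u v, π.Rel u v → σ.Rel a u → u ∈ Set.Ioc a c → v ∈ Set.Ioc a c := by
            intro u v huv hu hmem
            have hav := hu.trans (le_iff.1 h _ _ huv)
            refine ⟨?_, hcmax v hav⟩
            by_contra hle
            have hiv : i < v := by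
              by_contra hle'
              exact hex ⟨v, hav, by omega⟩
            have hu' := hk' v u huv.symm hiv (by omega)
            exact absurd (hamax u hu hu'.1 hu'.2) (not_le.2 hmem.1)
          have hac : a ≤ c := by omega
          rw [min_eq_left hac, max_eq_right hac]
          exact fun u v huv hu hv => ⟨hside u v huv hu, hside v u huv.symm hv⟩
        have := hfin c this
        omega
    · intro hr
      refine ⟨le_iff.1 (kr_antitone h) _ _ hr, fun a b hab _ _ => ?_⟩
      exact hr a b (le_iff.1 (krel_le π σ) _ _ hab)
  ext i j
  rcases le_total i j with hij | hij
  · exact key i j hij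
  · exact ⟨fun h' => ((key j i hij).1 h'.symm).symm, fun h' => ((key j i hij).2 h'.symm).symm⟩

/-- `σ ↦ krel π σ` is a bijection from `[π, 1]` onto `[0, Kr(π)]`. -/
theorem sum_Ici_krel {M : Type*} [AddCommMonoid M] (π : NC n) (f : NC n → NC n → M) :
    ∑ σ ∈ Finset.Ici π, f (krel π σ) σ.kr = ∑ τ ∈ Finset.Iic π.kr, f τ (krel τ π.kr) := by
  have hinj : Set.InjOn (krel π) (Finset.Ici π : Set (NC n)) := by
    intro σ hσ σ' hσ' e
    rw [Finset.mem_coe, Finset.mem_Ici] at hσ hσ'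
    apply kr_injective
    rw [← krel_krel_kr hσ, ← krel_krel_kr hσ', e]
  have himg : (Finset.Ici π).image (krel π) = Finset.Iic π.kr := by
    refine Finset.eq_of_subset_of_card_le ?_ ?_
    · intro τ hτ
      obtain ⟨σ, hσ, rfl⟩ := Finset.mem_image.1 hτ
      exact Finset.mem_Iic.2 (krel_le_kr (Finset.mem_Ici.1 hσ))
    · rw [Finset.card_image_of_injOn hinj]
      have : Finset.Iic π.kr ⊆ (Finset.Ici π).image kr := by
        intro τ hτ
        obtain ⟨σ, rfl⟩ := kr_bijective.2 τ
        exact Finset.mem_image_of_mem _ (Finset.mem_Ici.2 (le_of_kr_le (Finset.mem_Iic.1 hτ)))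
      exact (Finset.card_le_card this).trans Finset.card_image_le
  rw [← himg, Finset.sum_image hinj]
  exact Finset.sum_congr rfl fun σ hσ => by rw [krel_krel_kr (Finset.mem_Ici.1 hσ)]

theorem eq_top_of_lt_two (hn : n < 2) (π : NC n) : π = ⊤ := by
  ext i j
  have : i = j := by omega
  subst this
  exact ⟨fun _ => top_rel _ _, fun _ => Rel.refl π i⟩

theorem card_pos_of_pos (π : NC n) (hn : 0 < n) : 0 < π.blocks.card :=
  Finset.card_pos.2 ⟨_, π.block_mem_blocks ⟨0, hn⟩⟩

theorem eq_top_of_card_blocks_le_one {π : NC n} (h : π.blocks.card ≤ 1) : π = ⊤ := by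
  ext i j
  refine ⟨fun _ => top_rel _ _, fun _ => ?_⟩
  have := Finset.card_le_one.1 h _ (π.block_mem_blocks i) _ (π.block_mem_blocks j)
  exact mem_block.1 (this ▸ π.self_mem_block j)

theorem card_lt_of_mem_blocks {σ : NC n} (hσ : σ ≠ ⊤) {W : Finset (Fin n)} (hW : W ∈ σ.blocks) :
    W.card < n := by
  by_contra hlt
  have hle : W.card ≤ n := by simpa using Finset.card_le_univ W
  have huniv : W = Finset.univ := (Finset.card_eq_iff_eq_univ W).1 (by simp; omega)
  refine hσ ?_
  ext i j
  refine ⟨fun _ => top_rel _ _, fun _ => rel_of_mem_blocks hW ?_ ?_⟩ <;> simp [huniv]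

theorem card_blocks_top (hn : 0 < n) : (⊤ : NC n).blocks.card = 1 := by
  rw [blocks_top hn, Finset.card_singleton]

theorem card_blocks_bot : (⊥ : NC n).blocks.card = n := by
  rw [blocks_bot, Finset.card_image_of_injective _ Finset.singleton_injective, Finset.card_univ,
    Fintype.card_fin]

theorem sum_card_blocks_restrict {ρ σ : NC n} (h : ρ ≤ σ) :
    ∑ W ∈ σ.blocks, (ρ.restrict W).blocks.card = ρ.blocks.card := by
  simp only [Finset.card_eq_sum_ones]
  exact (sum_blocks_of_le h fun _ => 1).symm

theorem sum_card_blocks (σ : NC n) : ∑ W ∈ σ.blocks, W.card = n := by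
  have := sum_card_blocks_restrict (bot_le (a := σ))
  simpa only [bot_restrict, card_blocks_bot] using this

theorem sum_tsub_one_blocks {σ : NC n} (f : Finset (Fin n) → ℕ) (hf : ∀ W ∈ σ.blocks, 1 ≤ f W) :
    ∑ W ∈ σ.blocks, (f W - 1) = ∑ W ∈ σ.blocks, f W - σ.blocks.card := by
  rw [Finset.sum_tsub_distrib _ hf, Finset.card_eq_sum_ones]

theorem card_blocks_le_of_le {ρ σ : NC n} (h : ρ ≤ σ) : σ.blocks.card ≤ ρ.blocks.card := by
  rw [← sum_card_blocks_restrict h, Finset.card_eq_sum_ones]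
  exact Finset.sum_le_sum fun W hW => card_pos_of_pos _ (card_pos_of_mem_blocks hW)

theorem card_blocks_le (σ : NC n) : σ.blocks.card ≤ n := by
  simpa only [card_blocks_bot] using card_blocks_le_of_le (bot_le (a := σ))

theorem forall_restrict_eq_top_iff {π σ : NC n} (h : π ≤ σ) :
    (∀ W ∈ σ.blocks, π.restrict W = ⊤) ↔ π = σ := by
  constructor
  · intro h'
    exact eq_of_restrict_eq h le_rfl fun W hW => (h' W hW).trans (restrict_self hW).symm
  · rintro rfl W hW
    exact restrict_self hW

theorem Ici_top : Finset.Ici (⊤ : NC n) = {⊤} := by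
  ext σ
  simp

theorem Ici_bot : Finset.Ici (⊥ : NC n) = Finset.univ := by
  ext σ
  simp

end NC

section GradedTensor

variable {A : Type*} [CommRing A] [Algebra ℂ A]

/-- The induced grading on `A ⊗ A`. -/
noncomputable def tensorGrading (𝒜 : ℕ → Submodule ℂ A) (m : ℕ) : Submodule ℂ (A ⊗[ℂ] A) :=
  ⨆ p ∈ Finset.HasAntidiagonal.antidiagonal m,
    LinearMap.range (TensorProduct.mapIncl (𝒜 p.1) (𝒜 p.2))

theorem tmul_mem_tensorGrading {𝒜 : ℕ → Submodule ℂ A} {i j : ℕ} {a b : A} (ha : a ∈ 𝒜 i)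
    (hb : b ∈ 𝒜 j) : a ⊗ₜ[ℂ] b ∈ tensorGrading 𝒜 (i + j) := by
  refine Submodule.mem_iSup_of_mem (i, j) (Submodule.mem_iSup_of_mem (by simp) ?_)
  exact ⟨⟨a, ha⟩ ⊗ₜ ⟨b, hb⟩, rfl⟩

theorem tensorGrading_le {𝒜 : ℕ → Submodule ℂ A} {m : ℕ} {N : Submodule ℂ (A ⊗[ℂ] A)}
    (h : ∀ i j, i + j = m → ∀ a ∈ 𝒜 i, ∀ b ∈ 𝒜 j, a ⊗ₜ[ℂ] b ∈ N) : tensorGrading 𝒜 m ≤ N := by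
  refine iSup₂_le fun p hp => ?_
  rw [TensorProduct.range_mapIncl]
  exact Submodule.map₂_le.2 fun a ha b hb => h _ _ (by simpa using hp) a ha b hb

theorem tensorGrading_gradedMonoid (𝒜 : ℕ → Submodule ℂ A) [SetLike.GradedMonoid 𝒜] :
    SetLike.GradedMonoid (tensorGrading 𝒜) where
  one_mem := tmul_mem_tensorGrading (i := 0) (j := 0) (SetLike.GradedOne.one_mem)
    (SetLike.GradedOne.one_mem)
  mul_mem := by
    intro m m' x y hx hy
    have h : tensorGrading 𝒜 m ≤
        (tensorGrading 𝒜 (m + m')).comap (LinearMap.mulRight ℂ y) := by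
      refine tensorGrading_le fun i j hij a ha b hb => ?_
      have h' : tensorGrading 𝒜 m' ≤
          (tensorGrading 𝒜 (m + m')).comap (LinearMap.mulLeft ℂ (a ⊗ₜ[ℂ] b)) := by
        refine tensorGrading_le fun i' j' hij' a' ha' b' hb' => ?_
        rw [Submodule.mem_comap, LinearMap.mulLeft_apply, Algebra.TensorProduct.tmul_mul_tmul]
        have : m + m' = (i + i') + (j + j') := by omega
        rw [this]
        exact tmul_mem_tensorGrading (SetLike.GradedMul.mul_mem ha ha')
          (SetLike.GradedMul.mul_mem hb hb')
      exact h' hy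
    exact h hx

end GradedTensor

section Weighted

variable {ι : Type*} (w : ι → ℕ)

theorem map_mem_of_weighted {B : Type*} [CommRing B] [Algebra ℂ B] (ℬ : ℕ → Submodule ℂ B)
    [SetLike.GradedMonoid ℬ] (φ : MvPolynomial ι ℂ →ₐ[ℂ] B)
    (h : ∀ i, φ (MvPolynomial.X i) ∈ ℬ (w i)) {m : ℕ} {a : MvPolynomial ι ℂ}
    (ha : a ∈ MvPolynomial.weightedHomogeneousSubmodule ℂ w m) : φ a ∈ ℬ m := by
  rw [MvPolynomial.mem_weightedHomogeneousSubmodule] at ha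
  induction ha using MvPolynomial.IsWeightedHomogeneous.induction_on with
  | zero => rw [map_zero]; exact zero_mem _
  | add p q _ _ hp hq => rw [map_add]; exact add_mem hp hq
  | monomial d r hr =>
    rw [MvPolynomial.monomial_eq, map_mul, ← MvPolynomial.algebraMap_eq, AlgHom.commutes,
      ← Algebra.smul_def, Finsupp.prod, map_prod]
    refine Submodule.smul_mem _ _ ?_
    rw [← hr, Finsupp.weight_apply, Finsupp.sum]
    simp only [map_pow]
    exact SetLike.prod_pow_mem_graded ℬ w _ d fun i _ => h i

theorem aeval_zero_eq_zero_of_weighted {m : ℕ} (hm : m ≠ 0) {a : MvPolynomial ι ℂ}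
    (ha : a ∈ MvPolynomial.weightedHomogeneousSubmodule ℂ w m) :
    MvPolynomial.aeval (fun _ : ι => (0 : ℂ)) a = 0 := by
  rw [MvPolynomial.mem_weightedHomogeneousSubmodule] at ha
  have : MvPolynomial.coeff 0 a = 0 := ha.coeff_eq_zero 0 (by simpa using hm.symm)
  rw [← MvPolynomial.constantCoeff_eq] at this
  simp [MvPolynomial.aeval_zero', this]

theorem weighted_zero_eq_span_one (hw : ∀ i, w i ≠ 0) :
    MvPolynomial.weightedHomogeneousSubmodule ℂ w 0 =
      Submodule.span ℂ {(1 : MvPolynomial ι ℂ)} := by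
  ext a
  rw [Submodule.mem_span_singleton, MvPolynomial.mem_weightedHomogeneousSubmodule]
  constructor
  · intro h
    refine ⟨MvPolynomial.coeff 0 a, ?_⟩
    conv_rhs => rw [← h.weightedHomogeneousComponent_same,
      MvPolynomial.weightedHomogeneousComponent_zero _ hw]
    rw [Algebra.smul_def, mul_one, MvPolynomial.algebraMap_eq]
  · rintro ⟨c, rfl⟩
    rw [Algebra.smul_def, mul_one, MvPolynomial.algebraMap_eq]
    exact MvPolynomial.isWeightedHomogeneous_C _ _

theorem weighted_isInternal :
    DirectSum.IsInternal (MvPolynomial.weightedHomogeneousSubmodule ℂ w) :=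
  letI := MvPolynomial.weightedGradedAlgebra ℂ w
  DirectSum.Decomposition.isInternal _

end Weighted

theorem prod_tmul_prod {A B κ : Type*} [CommRing A] [Algebra ℂ A] [CommRing B] [Algebra ℂ B]
    (s : Finset κ) (f : κ → A) (g : κ → B) :
    ∏ i ∈ s, f i ⊗ₜ[ℂ] g i = (∏ i ∈ s, f i) ⊗ₜ[ℂ] ∏ i ∈ s, g i := by
  classical
  induction s using Finset.induction_on with
  | empty => simp [Algebra.TensorProduct.one_def]
  | insert a s ha ih => simp [Finset.prod_insert ha, ih]

/-! ### The bialgebra `T` -/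

theorem X_top {n : ℕ} : X (⊤ : NC n) = 1 := dif_pos rfl

theorem X_of_ne {n : ℕ} {π : NC n} (h : π ≠ ⊤) : X π = MvPolynomial.X ⟨⟨n, π⟩, h⟩ := dif_neg h

theorem X_index (p : TIndex) : MvPolynomial.X p = X p.1.2 := (X_of_ne p.2).symm

theorem two_le_of_index (p : TIndex) : 2 ≤ p.1.1 := by
  by_contra h
  exact p.2 (NC.eq_top_of_lt_two (by omega) _)

theorem algHom_T_ext {B : Type*} [Semiring B] [Algebra ℂ B] {φ ψ : T →ₐ[ℂ] B}
    (h : ∀ (n : ℕ) (_ : 2 ≤ n) (π : NC n), φ (X π) = ψ (X π)) : φ = ψ :=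
  MvPolynomial.algHom_ext fun p => by
    rw [X_index]
    exact h _ (two_le_of_index p) _

theorem prod_X_self {n : ℕ} (π : NC n) : ∏ W ∈ π.blocks, X (π.restrict W) = 1 :=
  Finset.prod_eq_one fun W hW => by rw [NC.restrict_self hW, X_top]

theorem comulT_X {n : ℕ} (π : NC n) :
    comulT (X π) = ∑ σ ∈ Finset.Ici π, (∏ W ∈ σ.blocks, X (π.restrict W)) ⊗ₜ[ℂ] X σ := by
  by_cases h : π = ⊤
  · subst h
    rw [NC.Ici_top, Finset.sum_singleton, prod_X_self, X_top]
    exact map_one comulT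
  · rw [X_of_ne h]
    exact MvPolynomial.aeval_X _ _

open Classical in
theorem counitT_X {n : ℕ} (π : NC n) : counitT (X π) = if π = ⊤ then 1 else 0 := by
  by_cases h : π = ⊤
  · subst h
    rw [X_top, if_pos rfl]
    exact map_one counitT
  · rw [X_of_ne h, if_neg h]
    exact MvPolynomial.aeval_X _ _

theorem comulT_prod {n : ℕ} {π σ : NC n} (h : π ≤ σ) :
    comulT (∏ W ∈ σ.blocks, X (π.restrict W)) = ∑ ρ ∈ Finset.Icc π σ,
      (∏ U ∈ ρ.blocks, X (π.restrict U)) ⊗ₜ[ℂ] ∏ W ∈ σ.blocks, X (ρ.restrict W) := by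
  rw [map_prod]
  simp only [comulT_X]
  refine (NC.prod_sum_Ici h fun W ρ =>
    (∏ U ∈ ρ.blocks, X ((π.restrict W).restrict U)) ⊗ₜ[ℂ] X ρ).trans ?_
  refine Finset.sum_congr rfl fun ρ hρ => ?_
  rw [prod_tmul_prod, NC.prod_restrict (M := T) (Finset.mem_Icc.1 hρ).2 (fun _ τ => X τ)]

theorem coassocT : (Algebra.TensorProduct.assoc ℂ ℂ ℂ T T T).toAlgHom.comp
      ((Algebra.TensorProduct.map comulT (AlgHom.id ℂ T)).comp comulT) =
    (Algebra.TensorProduct.map (AlgHom.id ℂ T) comulT).comp comulT := by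
  refine algHom_T_ext (B := T ⊗[ℂ] (T ⊗[ℂ] T)) fun n _ π => ?_
  have hl : ((Algebra.TensorProduct.assoc ℂ ℂ ℂ T T T).toAlgHom.comp
      ((Algebra.TensorProduct.map comulT (AlgHom.id ℂ T)).comp comulT)) (X π) =
      ∑ σ ∈ Finset.Ici π, ∑ ρ ∈ Finset.Icc π σ, (∏ U ∈ ρ.blocks, X (π.restrict U)) ⊗ₜ[ℂ]
        ((∏ W ∈ σ.blocks, X (ρ.restrict W)) ⊗ₜ[ℂ] X σ) := by
    rw [AlgHom.comp_apply, AlgHom.comp_apply, comulT_X, map_sum, map_sum]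
    refine Finset.sum_congr rfl fun σ hσ => ?_
    rw [Algebra.TensorProduct.map_tmul, comulT_prod (Finset.mem_Ici.1 hσ),
      TensorProduct.sum_tmul, map_sum]
    rfl
  have hr : ((Algebra.TensorProduct.map (AlgHom.id ℂ T) comulT).comp comulT) (X π) =
      ∑ ρ ∈ Finset.Ici π, ∑ σ ∈ Finset.Ici ρ, (∏ U ∈ ρ.blocks, X (π.restrict U)) ⊗ₜ[ℂ]
        ((∏ W ∈ σ.blocks, X (ρ.restrict W)) ⊗ₜ[ℂ] X σ) := by
    rw [AlgHom.comp_apply, comulT_X, map_sum]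
    refine Finset.sum_congr rfl fun σ _ => ?_
    rw [Algebra.TensorProduct.map_tmul, comulT_X, TensorProduct.tmul_sum]
    rfl
  rw [hl, hr]
  refine Finset.sum_comm' fun σ ρ => ?_
  simp only [Finset.mem_Ici, Finset.mem_Icc]
  exact ⟨fun h => ⟨h.2.2, h.2.1⟩, fun h => ⟨h.2.trans h.1, h.2, h.1⟩⟩

theorem counit_leftT : (Algebra.TensorProduct.lid ℂ T).toAlgHom.comp
    ((Algebra.TensorProduct.map counitT (AlgHom.id ℂ T)).comp comulT) = AlgHom.id ℂ T := by
  refine algHom_T_ext fun n _ π => ?_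
  rw [AlgHom.comp_apply, AlgHom.comp_apply, comulT_X, map_sum, map_sum,
    Finset.sum_eq_single_of_mem π (Finset.mem_Ici.2 le_rfl)]
  · rw [prod_X_self, Algebra.TensorProduct.map_tmul, map_one]
    exact one_smul ℂ (X π)
  · intro σ hσ hne
    have : ∏ W ∈ σ.blocks, counitT (X (π.restrict W)) = 0 := by
      have h := mt (NC.forall_restrict_eq_top_iff (Finset.mem_Ici.1 hσ)).1 hne.symm
      push Not at h
      obtain ⟨W, hW, h⟩ := h
      exact Finset.prod_eq_zero hW (by rw [counitT_X, if_neg h])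
    rw [Algebra.TensorProduct.map_tmul, map_prod, this, TensorProduct.zero_tmul, map_zero]

theorem prod_blocks_top {n : ℕ} (hn : 0 < n) {R : Type*} [CommMonoid R] (F : ∀ m, NC m → R)
    (π : NC n) : ∏ W ∈ (⊤ : NC n).blocks, F _ (π.restrict W) = F n π := by
  rw [NC.blocks_top hn, Finset.prod_singleton, NC.apply_restrict_univ F]

theorem counit_rightT : (Algebra.TensorProduct.rid ℂ ℂ T).toAlgHom.comp
    ((Algebra.TensorProduct.map (AlgHom.id ℂ T) counitT).comp comulT) = AlgHom.id ℂ T := by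
  refine algHom_T_ext fun n hn π => ?_
  rw [AlgHom.comp_apply, AlgHom.comp_apply, comulT_X, map_sum, map_sum,
    Finset.sum_eq_single_of_mem ⊤ (Finset.mem_Ici.2 le_top)]
  · rw [prod_blocks_top (by omega) (fun _ τ => X τ), X_top, Algebra.TensorProduct.map_tmul, map_one]
    exact one_smul ℂ (X π)
  · intro σ _ hne
    rw [Algebra.TensorProduct.map_tmul, counitT_X, if_neg hne, TensorProduct.tmul_zero, map_zero]

theorem gradT_gradedMonoid : SetLike.GradedMonoid gradT :=
  MvPolynomial.WeightedHomogeneousSubmodule.gradedMonoid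

theorem X_mem_gradT {n : ℕ} (π : NC n) : X π ∈ gradT (π.blocks.card - 1) := by
  have := gradT_gradedMonoid
  by_cases h : π = ⊤
  · subst h
    have : (⊤ : NC n).blocks.card - 1 = 0 := by
      rcases Nat.eq_zero_or_pos n with rfl | hn
      · have := NC.card_blocks_le (⊤ : NC 0)
        omega
      · rw [NC.card_blocks_top hn]
    rw [X_top, this]
    exact SetLike.GradedOne.one_mem
  · rw [X_of_ne h]
    exact MvPolynomial.isWeightedHomogeneous_X ℂ _ (⟨⟨n, π⟩, h⟩ : TIndex)

theorem comulT_X_mem (p : TIndex) :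
    comulT (MvPolynomial.X p) ∈ tensorGrading gradT (p.1.2.blocks.card - 1) := by
  have := gradT_gradedMonoid
  obtain ⟨⟨n, π⟩, hp⟩ := p
  have hn : 2 ≤ n := two_le_of_index ⟨⟨n, π⟩, hp⟩
  rw [X_index, comulT_X]
  refine sum_mem fun σ hσ => ?_
  have hle := Finset.mem_Ici.1 hσ
  have hdeg : π.blocks.card - 1 =
      ∑ W ∈ σ.blocks, ((π.restrict W).blocks.card - 1) + (σ.blocks.card - 1) := by
    rw [NC.sum_tsub_one_blocks _ fun W hW =>
      NC.card_pos_of_pos _ (NC.card_pos_of_mem_blocks hW), NC.sum_card_blocks_restrict hle]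
    have h1 := NC.card_blocks_le_of_le hle
    have h2 := NC.card_pos_of_pos σ (show 0 < n by omega)
    exact (Nat.sub_add_sub_cancel h1 h2).symm
  have h := tmul_mem_tensorGrading (SetLike.prod_mem_graded gradT _ _ fun W _ =>
    X_mem_gradT (π.restrict W)) (X_mem_gradT σ) (i := ∑ W ∈ σ.blocks, _)
  rw [hdeg]
  exact h

theorem isGradedConnectedBialgebraT : IsGradedConnectedBialgebra comulT counitT gradT where
  coassoc := coassocT
  counit_left := counit_leftT
  counit_right := counit_rightT
  gradedMonoid := gradT_gradedMonoid
  isInternal := weighted_isInternal _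
  comul_mem := fun _ _ ha => by
    have := gradT_gradedMonoid
    have := tensorGrading_gradedMonoid gradT
    exact map_mem_of_weighted _ (tensorGrading gradT) comulT comulT_X_mem ha
  counit_eq_zero := fun _ hm _ ha => aeval_zero_eq_zero_of_weighted _ hm ha
  connected := weighted_zero_eq_span_one _ fun p h => p.2
    (NC.eq_top_of_card_blocks_le_one (by omega))

section Transfer

variable {A B : Type*} [CommRing A] [Algebra ℂ A] [CommRing B] [Algebra ℂ B]
  {Δ : A →ₐ[ℂ] A ⊗[ℂ] A} {ε : A →ₐ[ℂ] ℂ} {Δ' : B →ₐ[ℂ] B ⊗[ℂ] B} {ε' : B →ₐ[ℂ] ℂ} {φ : A →ₐ[ℂ] B}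

theorem coassoc_of_surjective (hφ : Function.Surjective φ)
    (hΔ : Δ'.comp φ = (Algebra.TensorProduct.map φ φ).comp Δ)
    (h : (Algebra.TensorProduct.assoc ℂ ℂ ℂ A A A).toAlgHom.comp
        ((Algebra.TensorProduct.map Δ (AlgHom.id ℂ A)).comp Δ) =
      (Algebra.TensorProduct.map (AlgHom.id ℂ A) Δ).comp Δ) :
    (Algebra.TensorProduct.assoc ℂ ℂ ℂ B B B).toAlgHom.comp
        ((Algebra.TensorProduct.map Δ' (AlgHom.id ℂ B)).comp Δ') =
      (Algebra.TensorProduct.map (AlgHom.id ℂ B) Δ').comp Δ' := by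
  refine (AlgHom.cancel_right hφ).1 ?_
  have hl : (Algebra.TensorProduct.map Δ' (AlgHom.id ℂ B)).comp (Algebra.TensorProduct.map φ φ) =
      (Algebra.TensorProduct.map (Algebra.TensorProduct.map φ φ) φ).comp
        (Algebra.TensorProduct.map Δ (AlgHom.id ℂ A)) := by
    rw [← Algebra.TensorProduct.map_comp, ← Algebra.TensorProduct.map_comp, hΔ,
      AlgHom.id_comp, AlgHom.comp_id]
  have hr : (Algebra.TensorProduct.map (AlgHom.id ℂ B) Δ').comp (Algebra.TensorProduct.map φ φ) =
      (Algebra.TensorProduct.map φ (Algebra.TensorProduct.map φ φ)).comp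
        (Algebra.TensorProduct.map (AlgHom.id ℂ A) Δ) := by
    rw [← Algebra.TensorProduct.map_comp, ← Algebra.TensorProduct.map_comp, hΔ,
      AlgHom.id_comp, AlgHom.comp_id]
  have ha : (Algebra.TensorProduct.assoc ℂ ℂ ℂ B B B).toAlgHom.comp
      (Algebra.TensorProduct.map (Algebra.TensorProduct.map φ φ) φ) =
      (Algebra.TensorProduct.map φ (Algebra.TensorProduct.map φ φ)).comp
        (Algebra.TensorProduct.assoc ℂ ℂ ℂ A A A).toAlgHom := by
    ext <;> simp [Algebra.TensorProduct.one_def]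
  rw [AlgHom.comp_assoc, AlgHom.comp_assoc, hΔ, ← AlgHom.comp_assoc (φ₃ := Δ), hl,
    AlgHom.comp_assoc, ← AlgHom.comp_assoc, ha, AlgHom.comp_assoc, h, AlgHom.comp_assoc, hΔ,
    ← AlgHom.comp_assoc, ← AlgHom.comp_assoc, hr]

theorem counit_left_of_surjective (hφ : Function.Surjective φ)
    (hΔ : Δ'.comp φ = (Algebra.TensorProduct.map φ φ).comp Δ) (hε : ε'.comp φ = ε)
    (h : (Algebra.TensorProduct.lid ℂ A).toAlgHom.comp
      ((Algebra.TensorProduct.map ε (AlgHom.id ℂ A)).comp Δ) = AlgHom.id ℂ A) :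
    (Algebra.TensorProduct.lid ℂ B).toAlgHom.comp
      ((Algebra.TensorProduct.map ε' (AlgHom.id ℂ B)).comp Δ') = AlgHom.id ℂ B := by
  refine (AlgHom.cancel_right hφ).1 ?_
  have hl : (Algebra.TensorProduct.lid ℂ B).toAlgHom.comp
      ((Algebra.TensorProduct.map ε' (AlgHom.id ℂ B)).comp (Algebra.TensorProduct.map φ φ)) =
      φ.comp ((Algebra.TensorProduct.lid ℂ A).toAlgHom.comp
        (Algebra.TensorProduct.map ε (AlgHom.id ℂ A))) := by
    subst hε
    ext <;> simp
  rw [AlgHom.comp_assoc, AlgHom.comp_assoc, hΔ, ← AlgHom.comp_assoc (φ₃ := Δ),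
    ← AlgHom.comp_assoc (φ₃ := Δ), hl, AlgHom.comp_assoc, AlgHom.comp_assoc, h, AlgHom.id_comp,
    AlgHom.comp_id]

theorem counit_right_of_surjective (hφ : Function.Surjective φ)
    (hΔ : Δ'.comp φ = (Algebra.TensorProduct.map φ φ).comp Δ) (hε : ε'.comp φ = ε)
    (h : (Algebra.TensorProduct.rid ℂ ℂ A).toAlgHom.comp
      ((Algebra.TensorProduct.map (AlgHom.id ℂ A) ε).comp Δ) = AlgHom.id ℂ A) :
    (Algebra.TensorProduct.rid ℂ ℂ B).toAlgHom.comp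
      ((Algebra.TensorProduct.map (AlgHom.id ℂ B) ε').comp Δ') = AlgHom.id ℂ B := by
  refine (AlgHom.cancel_right hφ).1 ?_
  have hl : (Algebra.TensorProduct.rid ℂ ℂ B).toAlgHom.comp
      ((Algebra.TensorProduct.map (AlgHom.id ℂ B) ε').comp (Algebra.TensorProduct.map φ φ)) =
      φ.comp ((Algebra.TensorProduct.rid ℂ ℂ A).toAlgHom.comp
        (Algebra.TensorProduct.map (AlgHom.id ℂ A) ε)) := by
    subst hε
    ext <;> simp
  rw [AlgHom.comp_assoc, AlgHom.comp_assoc, hΔ, ← AlgHom.comp_assoc (φ₃ := Δ),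
    ← AlgHom.comp_assoc (φ₃ := Δ), hl, AlgHom.comp_assoc, AlgHom.comp_assoc, h, AlgHom.id_comp,
    AlgHom.comp_id]

end Transfer

/-! ### The bialgebra `Sym` and the homomorphism `Ψ` -/

theorem Y_of_lt {n : ℕ} (h : n < 2) : Y n = 1 := dif_neg (by omega)

theorem Y_of_le {n : ℕ} (h : 2 ≤ n) : Y n = MvPolynomial.X ⟨n, h⟩ := dif_pos h

theorem Y_index (n : {n : ℕ // 2 ≤ n}) : MvPolynomial.X n = Y n.1 := (Y_of_le n.2).symm

theorem YP_bot {n : ℕ} : YP (⊥ : NC n) = 1 := by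
  rw [YP, NC.blocks_bot]
  refine Finset.prod_eq_one fun W hW => ?_
  obtain ⟨i, -, rfl⟩ := Finset.mem_image.1 hW
  exact Y_of_lt (by simp)

theorem YP_of_lt_two {n : ℕ} (hn : n < 2) (π : NC n) : YP π = 1 := by
  rw [NC.eq_top_of_lt_two hn π, ← NC.eq_top_of_lt_two hn ⊥, YP_bot]

theorem YP_top {n : ℕ} : YP (⊤ : NC n) = Y n := by
  by_cases hn : n < 2
  · rw [YP_of_lt_two hn, Y_of_lt hn]
  · rw [YP, NC.blocks_top (by omega), Finset.prod_singleton, Finset.card_univ, Fintype.card_fin]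

theorem prod_YP_restrict {n : ℕ} {ρ σ : NC n} (h : ρ ≤ σ) :
    ∏ W ∈ σ.blocks, YP (ρ.restrict W) = YP ρ := by
  rw [YP, NC.prod_blocks_of_le h]
  simp only [Finset.card_map]
  rfl

theorem prod_YP_restrict_kr {n : ℕ} (π σ : NC n) :
    ∏ W ∈ σ.blocks, YP (π.restrict W).kr = YP (NC.krel π σ) := by
  rw [← prod_YP_restrict (NC.krel_le π σ)]
  exact Finset.prod_congr rfl fun W hW => by rw [NC.krel_restrict π hW]

theorem comulSym_Y (n : ℕ) : comulSym (Y n) = ∑ π : NC n, YP π ⊗ₜ[ℂ] YP π.kr := by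
  by_cases hn : n < 2
  · rw [Fintype.sum_eq_single ⊤ fun π hπ => absurd (NC.eq_top_of_lt_two hn π) hπ,
      YP_of_lt_two hn, YP_of_lt_two hn, Y_of_lt hn]
    exact map_one comulSym
  · rw [Y_of_le (by omega)]
    exact MvPolynomial.aeval_X _ _

theorem counitSym_Y {n : ℕ} (hn : 2 ≤ n) : counitSym (Y n) = 0 := by
  rw [Y_of_le hn]
  exact MvPolynomial.aeval_X _ _

theorem comulSym_YP {n : ℕ} (κ : NC n) :
    comulSym (YP κ) = ∑ τ ∈ Finset.Iic κ, YP τ ⊗ₜ[ℂ] YP (NC.krel τ κ) := by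
  rw [YP, map_prod]
  simp only [comulSym_Y, ← NC.Ici_bot]
  have h := NC.prod_sum_Ici (bot_le (a := κ)) fun W (τ : NC W.card) => YP τ ⊗ₜ[ℂ] YP τ.kr
  simp only [NC.bot_restrict] at h
  rw [h, Finset.Icc_bot]
  refine Finset.sum_congr rfl fun τ hτ => ?_
  rw [prod_tmul_prod, prod_YP_restrict (Finset.mem_Iic.1 hτ), prod_YP_restrict_kr]

theorem Psi_X {n : ℕ} (π : NC n) : Psi (X π) = YP π.kr := by
  by_cases h : π = ⊤
  · subst h
    rw [X_top, NC.kr_top, YP_bot]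
    exact map_one Psi
  · rw [X_of_ne h]
    exact MvPolynomial.aeval_X _ _

theorem Psi_X_bot (n : ℕ) : Psi (X (⊥ : NC n)) = Y n := by rw [Psi_X, NC.kr_bot, YP_top]

theorem Psi_surjective : Function.Surjective Psi := by
  have : Psi.comp (MvPolynomial.aeval fun n : {n : ℕ // 2 ≤ n} => X (⊥ : NC n.1)) =
      AlgHom.id ℂ SymAlg :=
    MvPolynomial.algHom_ext fun n => by
      rw [AlgHom.comp_apply, MvPolynomial.aeval_X, Psi_X_bot, Y_index]
      rfl
  exact fun y => ⟨_, AlgHom.congr_fun this y⟩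

theorem Psi_comul : comulSym.comp Psi = (Algebra.TensorProduct.map Psi Psi).comp comulT := by
  refine algHom_T_ext (B := SymAlg ⊗[ℂ] SymAlg) fun n _ π => ?_
  rw [AlgHom.comp_apply, AlgHom.comp_apply, Psi_X, comulSym_YP, comulT_X, map_sum,
    ← NC.sum_Ici_krel π fun τ τ' => YP τ ⊗ₜ[ℂ] YP τ']
  refine Finset.sum_congr rfl fun σ _ => ?_
  rw [Algebra.TensorProduct.map_tmul, map_prod]
  simp only [Psi_X]
  rw [prod_YP_restrict_kr]

theorem Psi_counit : counitSym.comp Psi = counitT := by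
  refine algHom_T_ext fun n hn π => ?_
  rw [AlgHom.comp_apply, Psi_X, counitT_X]
  split_ifs with h
  · rw [h, NC.kr_top, YP_bot]
    exact map_one counitSym
  · have hcard : ∃ W ∈ π.kr.blocks, 2 ≤ W.card := by
      by_contra hcon
      push Not at hcon
      have h1 := NC.sum_card_blocks π.kr
      have h2 : ∑ W ∈ π.kr.blocks, W.card ≤ ∑ W ∈ π.kr.blocks, 1 :=
        Finset.sum_le_sum fun W hW => Nat.le_of_lt_succ (hcon W hW)
      rw [h1, ← Finset.card_eq_sum_ones] at h2
      have h3 := NC.card_blocks_add_card_blocks_kr π (by omega)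
      exact h (NC.eq_top_of_card_blocks_le_one (by omega))
    obtain ⟨W, hW, hc⟩ := hcard
    rw [YP, map_prod]
    exact Finset.prod_eq_zero hW (counitSym_Y hc)

theorem gradSym_gradedMonoid : SetLike.GradedMonoid gradSym :=
  MvPolynomial.WeightedHomogeneousSubmodule.gradedMonoid

theorem Y_mem_gradSym (n : ℕ) : Y n ∈ gradSym (n - 1) := by
  have := gradSym_gradedMonoid
  by_cases h : n < 2
  · rw [Y_of_lt h, show n - 1 = 0 by omega]
    exact SetLike.GradedOne.one_mem
  · rw [Y_of_le (by omega)]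
    exact MvPolynomial.isWeightedHomogeneous_X ℂ _ (⟨n, by omega⟩ : {n : ℕ // 2 ≤ n})

theorem YP_mem_gradSym {n : ℕ} (π : NC n) : YP π ∈ gradSym (n - π.blocks.card) := by
  have := gradSym_gradedMonoid
  have h := SetLike.prod_mem_graded (F := π.blocks) gradSym _ _ fun W _ => Y_mem_gradSym W.card
  rwa [NC.sum_tsub_one_blocks _ fun W hW => NC.card_pos_of_mem_blocks hW,
    NC.sum_card_blocks] at h

theorem YP_kr_mem_gradSym {n : ℕ} (hn : 0 < n) (π : NC n) :
    YP π.kr ∈ gradSym (π.blocks.card - 1) := by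
  have h := YP_mem_gradSym π.kr
  have h1 := NC.card_blocks_add_card_blocks_kr π hn
  rwa [show n - π.kr.blocks.card = π.blocks.card - 1 by omega] at h

theorem comulSym_X_mem (n : {n : ℕ // 2 ≤ n}) :
    comulSym (MvPolynomial.X n) ∈ tensorGrading gradSym (n.1 - 1) := by
  obtain ⟨n, hn⟩ := n
  have hpos : 0 < n := by omega
  rw [Y_index, comulSym_Y]
  refine sum_mem fun (π : NC n) _ => ?_
  have h := tmul_mem_tensorGrading (YP_mem_gradSym π) (YP_kr_mem_gradSym hpos π)
  have h1 := NC.card_blocks_le π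
  have h2 := NC.card_pos_of_pos π hpos
  rwa [show n - π.blocks.card + (π.blocks.card - 1) = n - 1 by omega] at h

theorem isGradedConnectedBialgebraSym :
    IsGradedConnectedBialgebra comulSym counitSym gradSym where
  coassoc := coassoc_of_surjective Psi_surjective Psi_comul coassocT
  counit_left := counit_left_of_surjective Psi_surjective Psi_comul Psi_counit counit_leftT
  counit_right := counit_right_of_surjective Psi_surjective Psi_comul Psi_counit counit_rightT
  gradedMonoid := gradSym_gradedMonoid
  isInternal := weighted_isInternal _
  comul_mem := fun _ _ ha => by
    have := gradSym_gradedMonoid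
    have := tensorGrading_gradedMonoid gradSym
    exact map_mem_of_weighted _ (tensorGrading gradSym) comulSym comulSym_X_mem ha
  counit_eq_zero := fun _ hm _ ha => aeval_zero_eq_zero_of_weighted _ hm ha
  connected := weighted_zero_eq_span_one _ fun n => by
    have := n.2
    omega

theorem isGradedBialgebraHom_Psi :
    IsGradedBialgebraHom comulT counitT gradT comulSym counitSym gradSym Psi where
  comul := Psi_comul
  counit := Psi_counit
  map_mem := fun _ _ ha => by
    have := gradSym_gradedMonoid
    refine map_mem_of_weighted _ gradSym Psi (fun p => ?_) ha
    rw [X_index, Psi_X]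
    have := two_le_of_index p
    exact YP_kr_mem_gradSym (by omega) _

/-! ### Groups of characters -/

section Characters

variable {A : Type*} [CommRing A] [Algebra ℂ A] {Δ : A →ₐ[ℂ] A ⊗[ℂ] A} {ε : A →ₐ[ℂ] ℂ}
  {𝒜 : ℕ → Submodule ℂ A}

theorem IsGradedConnectedBialgebra.conv_assoc (h : IsGradedConnectedBialgebra Δ ε 𝒜)
    (χ₁ χ₂ χ₃ : A →ₐ[ℂ] ℂ) : conv Δ (conv Δ χ₁ χ₂) χ₃ = conv Δ χ₁ (conv Δ χ₂ χ₃) := by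
  have hl : Algebra.TensorProduct.productMap ((Algebra.TensorProduct.productMap χ₁ χ₂).comp Δ) χ₃ =
      ((Algebra.TensorProduct.productMap χ₁ (Algebra.TensorProduct.productMap χ₂ χ₃)).comp
        (Algebra.TensorProduct.assoc ℂ ℂ ℂ A A A).toAlgHom).comp
          (Algebra.TensorProduct.map Δ (AlgHom.id ℂ A)) := by
    have : Algebra.TensorProduct.productMap (Algebra.TensorProduct.productMap χ₁ χ₂) χ₃ =
        (Algebra.TensorProduct.productMap χ₁ (Algebra.TensorProduct.productMap χ₂ χ₃)).comp
          (Algebra.TensorProduct.assoc ℂ ℂ ℂ A A A).toAlgHom := by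
      ext <;> simp [Algebra.TensorProduct.one_def]
    rw [← this]
    ext <;> simp
  have hr : Algebra.TensorProduct.productMap χ₁ ((Algebra.TensorProduct.productMap χ₂ χ₃).comp Δ) =
      (Algebra.TensorProduct.productMap χ₁ (Algebra.TensorProduct.productMap χ₂ χ₃)).comp
        (Algebra.TensorProduct.map (AlgHom.id ℂ A) Δ) := by
    ext <;> simp
  unfold conv
  rw [hl, hr, AlgHom.comp_assoc, AlgHom.comp_assoc, AlgHom.comp_assoc, h.coassoc]

theorem IsGradedConnectedBialgebra.counit_conv (h : IsGradedConnectedBialgebra Δ ε 𝒜)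
    (χ : A →ₐ[ℂ] ℂ) : conv Δ ε χ = χ := by
  have hl : Algebra.TensorProduct.productMap ε χ =
      (χ.comp (Algebra.TensorProduct.lid ℂ A).toAlgHom).comp
        (Algebra.TensorProduct.map ε (AlgHom.id ℂ A)) := by
    ext <;> simp
  unfold conv
  rw [hl, AlgHom.comp_assoc, AlgHom.comp_assoc, h.counit_left, AlgHom.comp_id]

/-- The group of characters of a graded connected bialgebra in which every character has a left
inverse. -/
@[reducible]
noncomputable def IsGradedConnectedBialgebra.charGroup (h : IsGradedConnectedBialgebra Δ ε 𝒜)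
    (hinv : ∀ χ : A →ₐ[ℂ] ℂ, ∃ χ', conv Δ χ' χ = ε) : Group (A →ₐ[ℂ] ℂ) :=
  letI : Mul (A →ₐ[ℂ] ℂ) := ⟨conv Δ⟩
  letI : One (A →ₐ[ℂ] ℂ) := ⟨ε⟩
  letI : Inv (A →ₐ[ℂ] ℂ) := ⟨fun χ => (hinv χ).choose⟩
  Group.ofLeftAxioms h.conv_assoc h.counit_conv fun χ => (hinv χ).choose_spec

end Characters

/-- Left inverses of characters of a polynomial algebra can be computed recursively if, up to
`x ⊗ 1`, the comultiplication of an indeterminate `x` involves on the left only indeterminates of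
smaller weight. -/
theorem exists_conv_eq {ι : Type*} (w : ι → ℕ)
    (Δ : MvPolynomial ι ℂ →ₐ[ℂ] MvPolynomial ι ℂ ⊗[ℂ] MvPolynomial ι ℂ)
    (h : ∀ (i : ι) (φ φ' χ : MvPolynomial ι ℂ →ₐ[ℂ] ℂ),
      (∀ j, w j < w i → φ (MvPolynomial.X j) = φ' (MvPolynomial.X j)) →
      conv Δ φ χ (MvPolynomial.X i) - φ (MvPolynomial.X i) =
        conv Δ φ' χ (MvPolynomial.X i) - φ' (MvPolynomial.X i))
    (χ ε : MvPolynomial ι ℂ →ₐ[ℂ] ℂ) : ∃ χ', conv Δ χ' χ = ε := by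
  let φ : ∀ i, (∀ j, w j < w i → ℂ) → MvPolynomial ι ℂ →ₐ[ℂ] ℂ := fun i v =>
    MvPolynomial.aeval fun j => if hj : w j < w i then v j hj else 0
  let F : ∀ i, (∀ j, w j < w i → ℂ) → ℂ := fun i v => ε (MvPolynomial.X i) -
    (conv Δ (φ i v) χ (MvPolynomial.X i) - φ i v (MvPolynomial.X i))
  let v : ι → ℂ := (measure w).wf.fix F
  have hv : ∀ i, v i = F i fun j _ => v j := fun i => (measure w).wf.fix_eq F i
  refine ⟨MvPolynomial.aeval v, MvPolynomial.algHom_ext fun i => ?_⟩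
  have hi := h i (MvPolynomial.aeval v) (φ i fun j _ => v j) χ fun j hj => by
    simp only [φ, MvPolynomial.aeval_X, dif_pos hj]
  rw [MvPolynomial.aeval_X, hv] at hi
  simp only [F] at hi
  linear_combination hi

theorem conv_comulT_X (χ₁ χ₂ : T →ₐ[ℂ] ℂ) {n : ℕ} (π : NC n) : conv comulT χ₁ χ₂ (X π) =
    ∑ σ ∈ Finset.Ici π, (∏ W ∈ σ.blocks, χ₁ (X (π.restrict W))) * χ₂ (X σ) := by
  rw [conv, AlgHom.comp_apply, comulT_X, map_sum]
  exact Finset.sum_congr rfl fun σ _ => by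
    rw [Algebra.TensorProduct.productMap_apply_tmul, map_prod]

theorem conv_comulSym_Y (χ₁ χ₂ : SymAlg →ₐ[ℂ] ℂ) (n : ℕ) : conv comulSym χ₁ χ₂ (Y n) =
    ∑ π : NC n, (∏ V ∈ π.blocks, χ₁ (Y V.card)) * χ₂ (YP π.kr) := by
  rw [conv, AlgHom.comp_apply, comulSym_Y, map_sum]
  exact Finset.sum_congr rfl fun σ _ => by
    rw [Algebra.TensorProduct.productMap_apply_tmul, YP, map_prod]

theorem exists_conv_comulT_eq (χ : T →ₐ[ℂ] ℂ) : ∃ χ', conv comulT χ' χ = counitT := by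
  refine exists_conv_eq (fun p : TIndex => p.1.1) comulT (fun p φ φ' χ hlt => ?_) χ counitT
  obtain ⟨⟨n, π⟩, hp⟩ := p
  have hn : 0 < n := Nat.lt_of_lt_of_le Nat.zero_lt_two (two_le_of_index ⟨⟨n, π⟩, hp⟩)
  have heq : ∀ {m : ℕ} (τ : NC m), m < n → φ (X τ) = φ' (X τ) := by
    intro m τ hm
    by_cases hτ : τ = ⊤
    · subst hτ
      rw [X_top, map_one, map_one]
    · rw [X_of_ne hτ]
      exact hlt _ hm
  rw [X_index, conv_comulT_X, conv_comulT_X,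
    ← Finset.add_sum_erase _ _ (Finset.mem_Ici.2 (le_top (a := π))),
    ← Finset.add_sum_erase _ _ (Finset.mem_Ici.2 (le_top (a := π))),
    prod_blocks_top hn fun _ τ => φ (X τ), prod_blocks_top hn fun _ τ => φ' (X τ),
    X_top, map_one, mul_one, mul_one, add_sub_cancel_left, add_sub_cancel_left]
  refine Finset.sum_congr rfl fun σ hσ => ?_
  congr 1
  exact Finset.prod_congr rfl fun W hW =>
    heq _ (NC.card_lt_of_mem_blocks (Finset.ne_of_mem_erase hσ) hW)

theorem exists_conv_comulSym_eq (χ : SymAlg →ₐ[ℂ] ℂ) : ∃ χ', conv comulSym χ' χ = counitSym := by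
  refine exists_conv_eq (fun n : {n : ℕ // 2 ≤ n} => n.1) comulSym (fun n φ φ' χ hlt => ?_) χ
    counitSym
  obtain ⟨n, hn⟩ := n
  have hpos : 0 < n := by omega
  have heq : ∀ m, m < n → φ (Y m) = φ' (Y m) := by
    intro m hm
    by_cases hm' : m < 2
    · rw [Y_of_lt hm', map_one, map_one]
    · rw [Y_of_le (by omega)]
      exact hlt _ hm
  rw [Y_index, conv_comulSym_Y, conv_comulSym_Y,
    ← Finset.add_sum_erase _ _ (Finset.mem_univ (⊤ : NC n)),
    ← Finset.add_sum_erase _ _ (Finset.mem_univ (⊤ : NC n)),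
    NC.blocks_top hpos, Finset.prod_singleton, Finset.prod_singleton, NC.kr_top, YP_bot, map_one,
    mul_one, mul_one, Finset.card_univ, Fintype.card_fin, add_sub_cancel_left,
    add_sub_cancel_left]
  refine Finset.sum_congr rfl fun σ hσ => ?_
  congr 1
  exact Finset.prod_congr rfl fun W hW =>
    heq _ (NC.card_lt_of_mem_blocks (Finset.ne_of_mem_erase hσ) hW)

/-- The group of characters of `T`. -/
@[reducible]
noncomputable def charGroupT : Group (T →ₐ[ℂ] ℂ) :=
  isGradedConnectedBialgebraT.charGroup exists_conv_comulT_eq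

/-- The group of characters of `Sym`. -/
@[reducible]
noncomputable def charGroupSym : Group (SymAlg →ₐ[ℂ] ℂ) :=
  isGradedConnectedBialgebraSym.charGroup exists_conv_comulSym_eq

/-! ### Semi-multiplicative functions -/

theorem IncAlg_ext {f g : IncAlg}
    (h : ∀ (n : ℕ) (hn : 0 < n) (π σ : NC n), π ≤ σ → ev f hn π σ = ev g hn π σ) : f = g := by
  ext p q hle
  obtain ⟨⟨n, hn⟩, π, σ, hle⟩ := hle
  exact h n hn π σ hle

theorem ev_mul (f g : IncAlg) {n : ℕ} (hn : 0 < n) (π σ : NC n) :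
    ev (f * g) hn π σ = ∑ ρ ∈ Finset.Icc π σ, ev f hn π ρ * ev g hn ρ σ := by
  rw [ev, IncidenceAlgebra.mul_apply, Sigma.Icc_mk_mk, Finset.sum_map]
  rfl

theorem ev_one {n : ℕ} (hn : 0 < n) (π σ : NC n) :
    ev 1 hn π σ = if π = σ then 1 else 0 := by
  rw [ev, IncidenceAlgebra.one_apply]
  simp

open Classical in
/-- The semi-multiplicative function of a character of `T`. -/
noncomputable def semiMulFun (χ : T →ₐ[ℂ] ℂ) : IncAlg where
  toFun p q := if h : ∃ e : p.1 = q.1, (e ▸ p.2 : NC q.1.1) ≤ q.2 then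
    ∏ W ∈ q.2.blocks, χ (X ((h.1 ▸ p.2 : NC q.1.1).restrict W)) else 0
  eq_zero_of_not_le' _ _ h := dif_neg fun h' => h (Sigma.le_def.2 h')

theorem ev_semiMulFun (χ : T →ₐ[ℂ] ℂ) {n : ℕ} (hn : 0 < n) {π σ : NC n} (h : π ≤ σ) :
    ev (semiMulFun χ) hn π σ = ∏ W ∈ σ.blocks, χ (X (π.restrict W)) :=
  dif_pos ⟨rfl, h⟩

theorem ev_semiMulFun_top (χ : T →ₐ[ℂ] ℂ) {n : ℕ} (hn : 0 < n) (π : NC n) :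
    ev (semiMulFun χ) hn π ⊤ = χ (X π) := by
  rw [ev_semiMulFun χ hn le_top, prod_blocks_top hn fun _ τ => χ (X τ)]

theorem semiMulFun_mem (χ : T →ₐ[ℂ] ℂ) : semiMulFun χ ∈ semiMultiplicative := by
  refine ⟨fun n hn π => ?_, fun n hn π σ h => ?_⟩
  · rw [ev_semiMulFun χ hn le_rfl, ← map_prod, prod_X_self, map_one]
  · rw [ev_semiMulFun χ hn h, ← Finset.prod_coe_sort]
    exact Finset.prod_congr rfl fun W _ => (ev_semiMulFun_top _ _ _).symm

theorem exists_semiMulFun_eq {g : IncAlg} (hg : g ∈ semiMultiplicative) :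
    ∃ χ : T →ₐ[ℂ] ℂ, semiMulFun χ = g := by
  let χ : T →ₐ[ℂ] ℂ := MvPolynomial.aeval fun p : TIndex =>
    ev g (Nat.lt_of_lt_of_le Nat.zero_lt_two (two_le_of_index p)) p.1.2 ⊤
  have hχ : ∀ {n : ℕ} (hn : 0 < n) (π : NC n), χ (X π) = ev g hn π ⊤ := by
    intro n hn π
    by_cases h : π = ⊤
    · subst h
      rw [X_top, map_one, hg.1]
    · rw [X_of_ne h]
      exact MvPolynomial.aeval_X _ _
  refine ⟨χ, IncAlg_ext fun n hn π σ h => ?_⟩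
  rw [ev_semiMulFun χ hn h, hg.2 n hn π σ h, ← Finset.prod_coe_sort]
  exact Finset.prod_congr rfl fun W _ => hχ _ _

theorem semiMulFun_injective : Function.Injective semiMulFun := fun χ χ' h =>
  algHom_T_ext fun n hn π => by
    have hpos : 0 < n := by omega
    rw [← ev_semiMulFun_top χ hpos, h, ev_semiMulFun_top]

theorem semiMulFun_conv (χ₁ χ₂ : T →ₐ[ℂ] ℂ) :
    semiMulFun (conv comulT χ₁ χ₂) = semiMulFun χ₁ * semiMulFun χ₂ := by
  refine IncAlg_ext fun n hn π σ h => ?_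
  rw [ev_semiMulFun _ hn h, ev_mul]
  simp only [conv_comulT_X]
  rw [NC.prod_sum_Ici h fun W ρ =>
    (∏ U ∈ ρ.blocks, χ₁ (X ((π.restrict W).restrict U))) * χ₂ (X ρ)]
  refine Finset.sum_congr rfl fun ρ hρ => ?_
  obtain ⟨h1, h2⟩ := Finset.mem_Icc.1 hρ
  rw [Finset.prod_mul_distrib, NC.prod_restrict h2 (fun _ τ => χ₁ (X τ)), ev_semiMulFun _ hn h1,
    ev_semiMulFun _ hn h2]

theorem semiMulFun_counit : semiMulFun counitT = 1 := by
  refine IncAlg_ext fun n hn π σ h => ?_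
  rw [ev_semiMulFun _ hn h, ev_one]
  split_ifs with heq
  · subst heq
    rw [← map_prod, prod_X_self, map_one]
  · have h' := mt (NC.forall_restrict_eq_top_iff h).1 heq
    push Not at h'
    obtain ⟨W, hW, h'⟩ := h'
    exact Finset.prod_eq_zero hW (by rw [counitT_X, if_neg h'])

theorem semiMulFun_mem_multiplicative_iff (χ : T →ₐ[ℂ] ℂ) :
    semiMulFun χ ∈ multiplicative ↔ ∃ χ' : SymAlg →ₐ[ℂ] ℂ, χ'.comp Psi = χ := by
  have hval : ∀ {n : ℕ} (hn : 0 < n) (π : NC n), ev (semiMulFun χ) hn ⊥ π.kr =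
      ∏ W ∈ π.kr.blocks, χ (X (⊥ : NC W.card)) := by
    intro n hn π
    rw [ev_semiMulFun χ hn bot_le]
    exact Finset.prod_congr rfl fun W _ => by rw [NC.bot_restrict]
  constructor
  · intro h
    let χ' : SymAlg →ₐ[ℂ] ℂ := MvPolynomial.aeval fun n : {n : ℕ // 2 ≤ n} => χ (X (⊥ : NC n.1))
    have hχ' : ∀ n, χ' (Y n) = χ (X (⊥ : NC n)) := by
      intro n
      by_cases hn : n < 2
      · rw [Y_of_lt hn, NC.eq_top_of_lt_two hn ⊥, X_top, map_one, map_one]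
      · rw [Y_of_le (by omega)]
        exact MvPolynomial.aeval_X _ _
    refine ⟨χ', algHom_T_ext fun n hn π => ?_⟩
    have hpos : 0 < n := by omega
    rw [AlgHom.comp_apply, Psi_X, YP, map_prod, ← ev_semiMulFun_top χ hpos, h.2 n hpos π,
      hval hpos]
    exact Finset.prod_congr rfl fun W _ => hχ' _
  · rintro ⟨χ', rfl⟩
    refine ⟨semiMulFun_mem _, fun n hn π => ?_⟩
    rw [hval hn, ev_semiMulFun_top, AlgHom.comp_apply, Psi_X, YP, map_prod]
    exact Finset.prod_congr rfl fun W _ => by rw [AlgHom.comp_apply, Psi_X_bot]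

theorem conv_comp_Psi (χ₁ χ₂ : SymAlg →ₐ[ℂ] ℂ) : (conv comulSym χ₁ χ₂).comp Psi =
    conv comulT (χ₁.comp Psi) (χ₂.comp Psi) := by
  have : Algebra.TensorProduct.productMap (χ₁.comp Psi) (χ₂.comp Psi) =
      (Algebra.TensorProduct.productMap χ₁ χ₂).comp (Algebra.TensorProduct.map Psi Psi) := by
    refine Algebra.TensorProduct.ext' fun a b => ?_
    simp
  rw [conv, conv, this, AlgHom.comp_assoc, AlgHom.comp_assoc, Psi_comul]

section Groups

attribute [local instance] charGroupT charGroupSym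

/-- The homomorphism `χ ↦ χ ∘ Ψ` between the groups of characters. -/
noncomputable def psiStar : (SymAlg →ₐ[ℂ] ℂ) →* (T →ₐ[ℂ] ℂ) where
  toFun χ := χ.comp Psi
  map_one' := Psi_counit
  map_mul' := conv_comp_Psi

theorem psiStar_injective : Function.Injective psiStar := fun _ _ h =>
  (AlgHom.cancel_right Psi_surjective).1 h

/-- The homomorphism from the characters of `T` to the units of the incidence algebra. -/
noncomputable def unitOfChar : (T →ₐ[ℂ] ℂ) →* IncAlgˣ :=
  MonoidHom.toHomUnits
    { toFun := semiMulFun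
      map_one' := semiMulFun_counit
      map_mul' := semiMulFun_conv }

theorem coe_unitOfChar (χ : T →ₐ[ℂ] ℂ) : (unitOfChar χ : IncAlg) = semiMulFun χ := rfl

theorem unitOfChar_injective : Function.Injective unitOfChar := fun χ χ' h =>
  semiMulFun_injective (by rw [← coe_unitOfChar, h, coe_unitOfChar])

theorem unitOfChar_comp_psiStar_injective : Function.Injective (unitOfChar.comp psiStar) :=
  unitOfChar_injective.comp psiStar_injective

theorem image_range_unitOfChar : (fun u : IncAlgˣ => (u : IncAlg)) ''
    (unitOfChar.range : Set IncAlgˣ) = semiMultiplicative := by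
  ext g
  constructor
  · rintro ⟨_, ⟨χ, rfl⟩, rfl⟩
    exact semiMulFun_mem χ
  · intro hg
    obtain ⟨χ, rfl⟩ := exists_semiMulFun_eq hg
    exact ⟨_, ⟨χ, rfl⟩, rfl⟩

theorem image_range_unitOfChar_comp_psiStar : (fun u : IncAlgˣ => (u : IncAlg)) ''
    ((unitOfChar.comp psiStar).range : Set IncAlgˣ) = multiplicative := by
  ext g
  constructor
  · rintro ⟨_, ⟨χ, rfl⟩, rfl⟩
    exact (semiMulFun_mem_multiplicative_iff _).2 ⟨χ, rfl⟩
  · intro hg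
    obtain ⟨χ, rfl⟩ := exists_semiMulFun_eq hg.1
    obtain ⟨χ', rfl⟩ := (semiMulFun_mem_multiplicative_iff _).1 hg
    exact ⟨_, ⟨χ', rfl⟩, rfl⟩

theorem range_comp_le : (unitOfChar.comp psiStar).range ≤ unitOfChar.range := by
  rintro _ ⟨χ, rfl⟩
  exact ⟨psiStar χ, rfl⟩

/-- Semi-multiplicative functions are characters of `T`. -/
noncomputable def charEquivT : unitOfChar.range ≃* (T →ₐ[ℂ] ℂ) :=
  (MonoidHom.ofInjective unitOfChar_injective).symm

/-- Multiplicative functions are characters of `Sym`. -/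
noncomputable def charEquivSym : (unitOfChar.comp psiStar).range ≃* (SymAlg →ₐ[ℂ] ℂ) :=
  (MonoidHom.ofInjective unitOfChar_comp_psiStar_injective).symm

theorem charEquivT_X (g : unitOfChar.range) {n : ℕ} (hn : 0 < n) (π : NC n) :
    charEquivT g (X π) = ev ((g : IncAlgˣ) : IncAlg) hn π ⊤ := by
  obtain ⟨χ, rfl⟩ := (MonoidHom.ofInjective unitOfChar_injective).surjective g
  rw [charEquivT, MulEquiv.symm_apply_apply]
  exact (ev_semiMulFun_top χ hn π).symm

theorem psiStar_charEquivSym (f : (unitOfChar.comp psiStar).range) :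
    psiStar (charEquivSym f) = charEquivT (Subgroup.inclusion range_comp_le f) := by
  obtain ⟨χ, rfl⟩ := (MonoidHom.ofInjective unitOfChar_comp_psiStar_injective).surjective f
  rw [charEquivSym, MulEquiv.symm_apply_apply, charEquivT, MulEquiv.eq_symm_apply]
  rfl

theorem charEquivSym_Y (f : (unitOfChar.comp psiStar).range) {n : ℕ} (hn : 0 < n) :
    charEquivSym f (Y n) = ev ((f : IncAlgˣ) : IncAlg) hn ⊥ ⊤ := by
  rw [← Psi_X_bot]
  exact (AlgHom.congr_fun (psiStar_charEquivSym f) _).trans (charEquivT_X _ hn ⊥)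

end Groups

end NCHopf

theorem mainTheorem10 :
    -- `T` and `Sym` are graded connected bialgebras
    NCHopf.IsGradedConnectedBialgebra NCHopf.comulT NCHopf.counitT NCHopf.gradT ∧
    NCHopf.IsGradedConnectedBialgebra NCHopf.comulSym NCHopf.counitSym NCHopf.gradSym ∧
    -- `Ψ` is a surjective homomorphism of graded connected bialgebras
    (∀ (n : ℕ) (π : NCHopf.NC n), 0 < n →
      NCHopf.Psi (NCHopf.X π) = ∏ W ∈ π.kr.blocks, NCHopf.Y W.card) ∧
    NCHopf.IsGradedBialgebraHom NCHopf.comulT NCHopf.counitT NCHopf.gradT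
      NCHopf.comulSym NCHopf.counitSym NCHopf.gradSym NCHopf.Psi ∧
    Function.Surjective NCHopf.Psi ∧
    -- the characters of `T` and of `Sym` form groups under convolution
    ∃ (_ : Group (NCHopf.T →ₐ[ℂ] ℂ)) (_ : Group (NCHopf.SymAlg →ₐ[ℂ] ℂ)),
      (∀ χ₁ χ₂ : NCHopf.T →ₐ[ℂ] ℂ, χ₁ * χ₂ = NCHopf.conv NCHopf.comulT χ₁ χ₂) ∧
      (∀ χ₁ χ₂ : NCHopf.SymAlg →ₐ[ℂ] ℂ, χ₁ * χ₂ = NCHopf.conv NCHopf.comulSym χ₁ χ₂) ∧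
      (1 : NCHopf.T →ₐ[ℂ] ℂ) = NCHopf.counitT ∧
      (1 : NCHopf.SymAlg →ₐ[ℂ] ℂ) = NCHopf.counitSym ∧
      -- `Ψ*` is an injective group homomorphism
      ∃ PsiStar : (NCHopf.SymAlg →ₐ[ℂ] ℂ) →* (NCHopf.T →ₐ[ℂ] ℂ),
        (∀ χ : NCHopf.SymAlg →ₐ[ℂ] ℂ, PsiStar χ = χ.comp NCHopf.Psi) ∧
        Function.Injective PsiStar ∧
        -- the groups `Gt` of semi-multiplicative and `G` of multiplicative functions
        ∃ (Gt G : Subgroup NCHopf.IncAlgˣ) (hle : G ≤ Gt),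
          (fun u : NCHopf.IncAlgˣ => (u : NCHopf.IncAlg)) '' (Gt : Set NCHopf.IncAlgˣ) =
            NCHopf.semiMultiplicative ∧
          (fun u : NCHopf.IncAlgˣ => (u : NCHopf.IncAlg)) '' (G : Set NCHopf.IncAlgˣ) =
            NCHopf.multiplicative ∧
          -- the identifications of `Gt` and `G` with the groups of characters of `T` and `Sym`
          ∃ (eT : Gt ≃* (NCHopf.T →ₐ[ℂ] ℂ)) (eS : G ≃* (NCHopf.SymAlg →ₐ[ℂ] ℂ)),
            (∀ (g : Gt) (n : ℕ) (hn : 0 < n) (π : NCHopf.NC n),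
              eT g (NCHopf.X π) = NCHopf.ev ((g : NCHopf.IncAlgˣ) : NCHopf.IncAlg) hn π ⊤) ∧
            (∀ (f : G) (n : ℕ) (hn : 0 < n),
              eS f (NCHopf.Y n) = NCHopf.ev ((f : NCHopf.IncAlgˣ) : NCHopf.IncAlg) hn ⊥ ⊤) ∧
            -- `Ψ*` is the inclusion of `G` into `Gt`
            ∀ f : G, PsiStar (eS f) = eT (Subgroup.inclusion hle f) :=
  ⟨NCHopf.isGradedConnectedBialgebraT, NCHopf.isGradedConnectedBialgebraSym,
    fun _ π _ => NCHopf.Psi_X π, NCHopf.isGradedBialgebraHom_Psi, NCHopf.Psi_surjective,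
    NCHopf.charGroupT, NCHopf.charGroupSym, fun _ _ => rfl, fun _ _ => rfl, rfl, rfl,
    NCHopf.psiStar, fun _ => rfl, NCHopf.psiStar_injective, _, _, NCHopf.range_comp_le,
    NCHopf.image_range_unitOfChar, NCHopf.image_range_unitOfChar_comp_psiStar,
    NCHopf.charEquivT, NCHopf.charEquivSym, fun g _ hn π => NCHopf.charEquivT_X g hn π,
    fun f _ hn => NCHopf.charEquivSym_Y f hn, NCHopf.psiStar_charEquivSym⟩
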